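/- Let $r>0$, let $\mathbb T_{2\pi r^{-1}}=\mathbb R/2\pi r^{-1}\mathbb Z$ with its normalized Haar measure, let $\mathbb T$ be the unit circle in $\mathbb C$, and let $\mathcal F_r\colon L^2(\mathbb T_{2\pi r^{-1}})\to\ell_2(r\mathbb Z)$ be the Fourier transform, which maps the character $k\mapsto e^{ixk}$ to $\delta_x$ for every $x\in r\mathbb Z$. For a bounded measurable function $\rho$ let $M[\rho]$ be the operator of multiplication by $\rho$. A (one-dimensional, discrete-time) quantum walk is a triple $(\mathcal H,(U^t)_{t\in\mathbb Z},D)$ of a complex Hilbert space, a unitary representation of $\mathbb Z$ on it, and a (possibly unbounded) self-adjoint operator $D$ on $\mathcal H$. A bounded operator $X\colon\mathcal H_1\to\mathcal H_2$ is uniform (smooth) with respect to $D_1,D_2$ if $\mathbb R\ni k\mapsto e^{ikD_2}Xe^{-ikD_1}$ is continuous (of class $C^\infty$) in the operator norm. The walk is uniform if every $U^t$ is uniform with respect to $D,D$. Its uniform commutant is the set of all bounded operators $X$ on $\mathcal H$ with $XU=UX$ that are uniform with respect to $D,D$. Two walks are similar if there is a unitary operator $V\colon\mathcal H_1\to\mathcal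 H_2$ with $VU_1=U_2V$ that is smooth with respect to $D_1,D_2$. The direct sum of two walks is $(\mathcal H_1\oplus\mathcal H_2,(U_1^t\oplus U_2^t)_t,D_1\oplus D_2)$. Let $\lambda\colon\mathbb T_{2\pi r^{-1}}\to\mathbb T$ be a real analytic map that has no period other than $0$, and consider the prime model quantum walk $(\ell_2(r\mathbb Z),(U_\lambda^t)_{t\in\mathbb Z},D_r)$, where $U_\lambda=\mathcal F_rM[\lambda]\mathcal F_r^{-1}$ and $D_r\delta_x=x\delta_x$ for $x\in r\mathbb Z$ (with its maximal domain). Then: 1. the uniform commutant of this walk is equal to $\{\mathcal F_rM[\rho]\mathcal F_r^{-1} : \rho\colon\mathbb T_{2\pi r^{-1}}\to\mathbb C\text{ continuous}\}$; 2. this walk is not similar to any direct sum of two (not necessarily homogeneous) uniform quantum walks on non-zero Hilbert spaces. -/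

import Mathlib

open MeasureTheory AddCircle
open scoped ENNReal ContDiff

noncomputable section

namespace QW

universe u v

/-! ### Self-adjoint operators and the unitary groups they generate -/

section SelfAdjoint

variable {H : Type u} [NormedAddCommGroup H] [InnerProductSpace ℂ H] [CompleteSpace H]

/-- A densely defined symmetric operator whose domain contains the domain of its adjoint is
self-adjoint. -/
theorem isSelfAdjoint_of_maximal (D : H →ₗ.[ℂ] H) (hd : Dense (D.domain : Set H))
    (hs : ∀ x y : D.domain, inner ℂ (D x) (y : H) = inner ℂ (x : H) (D y))
    (hm : ∀ y w : H, (∀ x : D.domain, inner ℂ w (x : H) = inner ℂ y (D x)) → y ∈ D.domain) :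
    IsSelfAdjoint D := by
  rw [LinearPMap.isSelfAdjoint_def]
  have hle : D ≤ D.adjoint := LinearPMap.IsFormalAdjoint.le_adjoint hd hs
  refine (LinearPMap.eq_of_le_of_domain_eq hle (le_antisymm hle.1 ?_)).symm
  intro y hy
  exact hm y (D.adjoint ⟨y, hy⟩) fun x => LinearPMap.adjoint_isFormalAdjoint hd ⟨y, hy⟩ x

/-- `W` is the strongly continuous one-parameter unitary group `k ↦ exp (i k D)`: a vector `ξ` lies
in the domain of `D`, with `D ξ = η`, exactly when `k ↦ W k ξ` is differentiable at `0` with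
derivative `i η`. -/
structure IsUnitaryGroupOf (D : H →ₗ.[ℂ] H) (W : ℝ → (H ≃ₗᵢ[ℂ] H)) : Prop where
  zero : W 0 = 1
  add : ∀ s t : ℝ, W (s + t) = W s * W t
  cont : ∀ ξ : H, Continuous fun k : ℝ => W k ξ
  gen : ∀ ξ η : H, (ξ, η) ∈ D.graph ↔ HasDerivAt (fun k : ℝ => W k ξ) (Complex.I • η) 0

/-- A self-adjoint operator generates at most one unitary group. -/
theorem IsUnitaryGroupOf.unique {D : H →ₗ.[ℂ] H} (hD : IsSelfAdjoint D)
    {W W' : ℝ → (H ≃ₗᵢ[ℂ] H)} (h : IsUnitaryGroupOf D W) (h' : IsUnitaryGroupOf D W') :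
    W = W' := by
  have hd : Dense (D.domain : Set H) := hD.dense_domain
  have hsym : ∀ x y : D.domain, inner ℂ (D x) (y : H) = inner ℂ (x : H) (D y) := by
    have h1 := LinearPMap.adjoint_isFormalAdjoint hd
    rw [LinearPMap.isSelfAdjoint_def.1 hD] at h1
    exact h1
  -- the orbits of vectors in the domain solve the Schroedinger equation
  have key : ∀ {V : ℝ → (H ≃ₗᵢ[ℂ] H)}, IsUnitaryGroupOf D V → ∀ (ξ : H), ξ ∈ D.domain →
      ∀ t : ℝ, ∃ η : H, (V t ξ, η) ∈ D.graph ∧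
        HasDerivAt (fun k : ℝ => V k ξ) (Complex.I • η) t := by
    intro V hV ξ hξ t
    have h0 := (hV.gen ξ (D ⟨ξ, hξ⟩)).1 (D.mem_graph ⟨ξ, hξ⟩)
    refine ⟨V t (D ⟨ξ, hξ⟩), ?_, ?_⟩
    · rw [hV.gen]
      have h1 := ((V t).toContinuousLinearEquiv : H →L[ℂ] H).restrictScalars ℝ
        |>.hasFDerivAt.comp_hasDerivAt (0 : ℝ) h0
      have e : (fun k : ℝ => V k (V t ξ)) =
          (((V t).toContinuousLinearEquiv : H →L[ℂ] H).restrictScalars ℝ) ∘ fun k => V k ξ := by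
        funext k
        change (V k * V t) ξ = (V t * V k) ξ
        rw [← hV.add, ← hV.add, add_comm]
      rw [e]
      simpa using h1
    · have h0' : HasDerivAt (fun k : ℝ => V k ξ) (Complex.I • D ⟨ξ, hξ⟩) (t - t) := by
        simpa using h0
      have h2 := HasDerivAt.scomp (h := fun s : ℝ => s - t) t h0' ((hasDerivAt_id t).sub_const t)
      have h1 := ((V t).toContinuousLinearEquiv : H →L[ℂ] H).restrictScalars ℝ
        |>.hasFDerivAt.comp_hasDerivAt t h2
      have e : (fun k : ℝ => V k ξ) =
          (((V t).toContinuousLinearEquiv : H →L[ℂ] H).restrictScalars ℝ) ∘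
            ((fun k => V k ξ) ∘ fun s : ℝ => s - t) := by
        funext k
        change V k ξ = (V t * V (k - t)) ξ
        rw [← hV.add]
        simp
      rw [e]
      simpa using h1
  funext t
  have hdom : ∀ ξ ∈ D.domain, W t ξ = W' t ξ := by
    intro ξ hξ
    have hder : ∀ s : ℝ, HasDerivAt (fun k : ℝ => ‖W k ξ - W' k ξ‖ ^ 2) 0 s := by
      intro s
      obtain ⟨η, hη, hη'⟩ := key h ξ hξ s
      obtain ⟨ζ, hζ, hζ'⟩ := key h' ξ hξ s
      have hg : (W s ξ - W' s ξ, η - ζ) ∈ D.graph := D.graph.sub_mem hη hζ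
      have hdiff := hη'.sub hζ'
      let _ : InnerProductSpace ℝ H := InnerProductSpace.rclikeToReal ℂ H
      have h3 := hdiff.norm_sq
      have h4 : inner ℝ (W s ξ - W' s ξ) (Complex.I • η - Complex.I • ζ) = (0 : ℝ) := by
        rw [← smul_sub]
        obtain ⟨x, hx1, hx2⟩ := (D.mem_graph_iff).1 hg
        have hx1' : (x : H) = W s ξ - W' s ξ := hx1
        have hx2' : D x = η - ζ := hx2
        rw [← hx1', ← hx2', real_inner_eq_re_inner ℂ, inner_smul_right]
        have h5 := hsym x x
        have h6 : (starRingEnd ℂ) (inner ℂ (x : H) (D x)) = inner ℂ (x : H) (D x) := by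
          rw [inner_conj_symm, h5]
        have h7 := Complex.conj_eq_iff_im.1 h6
        simp [h7]
      have h5 : (2 : ℝ) * inner ℝ ((W s ξ) - (W' s ξ)) (Complex.I • η - Complex.I • ζ) = 0 := by
        rw [h4]; simp
      exact h5 ▸ h3
    have hconst := is_const_of_deriv_eq_zero
      (fun s => (hder s).differentiableAt) (fun s => (hder s).deriv) t 0
    have h0 : ‖W t ξ - W' t ξ‖ ^ 2 = 0 := by
      rw [hconst]
      simp [h.zero, h'.zero]
    exact sub_eq_zero.1 (norm_eq_zero.1 (pow_eq_zero_iff (two_ne_zero) |>.1 h0))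
  ext ξ
  have := Continuous.ext_on hd (W t).continuous (W' t).continuous hdom
  exact congrFun this ξ

open scoped Classical in
/-- The bounded operator `exp (i k D)` for a self-adjoint operator `D`. The unitary group
generated by `D` is unique by `IsUnitaryGroupOf.unique` and exists by Stone's theorem, so that the
value `1` in the second case is never used for a self-adjoint `D`. -/
def expI (D : H →ₗ.[ℂ] H) (k : ℝ) : H →L[ℂ] H :=
  if h : ∃ W : ℝ → (H ≃ₗᵢ[ℂ] H), IsUnitaryGroupOf D W then
    ((h.choose k).toContinuousLinearEquiv : H →L[ℂ] H)
  else 1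

end SelfAdjoint

/-! ### Regularity of operators -/

section Regularity

variable {H₁ : Type u} [NormedAddCommGroup H₁] [InnerProductSpace ℂ H₁] [CompleteSpace H₁]
variable {H₂ : Type v} [NormedAddCommGroup H₂] [InnerProductSpace ℂ H₂] [CompleteSpace H₂]

/-- The map `k ↦ exp (i k D₂) X exp (-i k D₁)`. -/
def conjFlow (D₁ : H₁ →ₗ.[ℂ] H₁) (D₂ : H₂ →ₗ.[ℂ] H₂) (X : H₁ →L[ℂ] H₂) (k : ℝ) : H₁ →L[ℂ] H₂ :=
  expI D₂ k ∘L X ∘L expI D₁ (-k)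

/-- `X` is uniform with respect to `D₁` and `D₂`: the map `k ↦ exp (i k D₂) X exp (-i k D₁)` is
continuous for the operator norm. -/
def IsUniformOp (D₁ : H₁ →ₗ.[ℂ] H₁) (D₂ : H₂ →ₗ.[ℂ] H₂) (X : H₁ →L[ℂ] H₂) : Prop :=
  Continuous (conjFlow D₁ D₂ X)

/-- `X` is smooth with respect to `D₁` and `D₂`: the map `k ↦ exp (i k D₂) X exp (-i k D₁)` is
smooth for the operator norm. -/
def IsSmoothOp (D₁ : H₁ →ₗ.[ℂ] H₁) (D₂ : H₂ →ₗ.[ℂ] H₂) (X : H₁ →L[ℂ] H₂) : Prop :=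
  ContDiff ℝ ∞ (conjFlow D₁ D₂ X)

end Regularity

/-! ### Quantum walks -/

/-- A (one-dimensional, discrete-time) quantum walk on the Hilbert space `H`: the unitary
representation `t ↦ U ^ t` of `ℤ`, given by its generator `U`, and a self-adjoint, possibly
unbounded operator `D`. -/
structure QuantumWalk (H : Type u) [NormedAddCommGroup H] [InnerProductSpace ℂ H]
    [CompleteSpace H] where
  U : H ≃ₗᵢ[ℂ] H
  D : H →ₗ.[ℂ] H
  selfAdjoint : IsSelfAdjoint D

section Walks

variable {H₁ : Type u} [NormedAddCommGroup H₁] [InnerProductSpace ℂ H₁] [CompleteSpace H₁]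
variable {H₂ : Type v} [NormedAddCommGroup H₂] [InnerProductSpace ℂ H₂] [CompleteSpace H₂]

/-- The operator `U ^ t`. -/
def QuantumWalk.evolution (W : QuantumWalk H₁) (t : ℤ) : H₁ →L[ℂ] H₁ :=
  ((W.U ^ t).toContinuousLinearEquiv : H₁ →L[ℂ] H₁)

/-- A quantum walk is uniform if every `U ^ t` is uniform with respect to `D`. -/
def QuantumWalk.IsUniform (W : QuantumWalk H₁) : Prop :=
  ∀ t : ℤ, IsUniformOp W.D W.D (W.evolution t)

/-- A bounded operator `X` with `X U₁ = U₂ X`. -/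
def IsIntertwiner (W₁ : QuantumWalk H₁) (W₂ : QuantumWalk H₂) (X : H₁ →L[ℂ] H₂) : Prop :=
  ∀ ξ : H₁, X (W₁.U ξ) = W₂.U (X ξ)

/-- The uniform commutant of a quantum walk: the uniform bounded operators that commute with
its generator. -/
def QuantumWalk.uniformCommutant (W : QuantumWalk H₁) : Set (H₁ →L[ℂ] H₁) :=
  {X | IsIntertwiner W W X ∧ IsUniformOp W.D W.D X}

/-- Two quantum walks are similar if there is a unitary smooth intertwiner between them. -/
def Similar (W₁ : QuantumWalk H₁) (W₂ : QuantumWalk H₂) : Prop :=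
  ∃ V : H₁ ≃ₗᵢ[ℂ] H₂,
    IsIntertwiner W₁ W₂ (V.toContinuousLinearEquiv : H₁ →L[ℂ] H₂) ∧
      IsSmoothOp W₁.D W₂.D (V.toContinuousLinearEquiv : H₁ →L[ℂ] H₂)

/-- The operator `D₁ ⊕ D₂` on the Hilbert space `H₁ ⊕ H₂`, with domain `dom D₁ ⊕ dom D₂`. -/
def directSumOp (D₁ : H₁ →ₗ.[ℂ] H₁) (D₂ : H₂ →ₗ.[ℂ] H₂) :
    WithLp 2 (H₁ × H₂) →ₗ.[ℂ] WithLp 2 (H₁ × H₂) where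
  domain :=
    { carrier := {p | p.fst ∈ D₁.domain ∧ p.snd ∈ D₂.domain}
      add_mem' := fun ha hb => ⟨D₁.domain.add_mem ha.1 hb.1, D₂.domain.add_mem ha.2 hb.2⟩
      zero_mem' := ⟨D₁.domain.zero_mem, D₂.domain.zero_mem⟩
      smul_mem' := fun c _ ha => ⟨D₁.domain.smul_mem c ha.1, D₂.domain.smul_mem c ha.2⟩ }
  toFun :=
    { toFun := fun p => WithLp.toLp 2 (D₁ ⟨p.1.fst, p.2.1⟩, D₂ ⟨p.1.snd, p.2.2⟩)
      map_add' := fun a b => by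
        have h1 := D₁.map_add ⟨a.1.fst, a.2.1⟩ ⟨b.1.fst, b.2.1⟩
        have h2 := D₂.map_add ⟨a.1.snd, a.2.2⟩ ⟨b.1.snd, b.2.2⟩
        exact congrArg (WithLp.toLp 2) (Prod.ext h1 h2)
      map_smul' := fun c a => by
        have h1 := D₁.map_smul c ⟨a.1.fst, a.2.1⟩
        have h2 := D₂.map_smul c ⟨a.1.snd, a.2.2⟩
        exact congrArg (WithLp.toLp 2) (Prod.ext h1 h2) }

theorem directSumOp_isSelfAdjoint {D₁ : H₁ →ₗ.[ℂ] H₁} {D₂ : H₂ →ₗ.[ℂ] H₂}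
    (h₁ : IsSelfAdjoint D₁) (h₂ : IsSelfAdjoint D₂) : IsSelfAdjoint (directSumOp D₁ D₂) := by
  have hd₁ := h₁.dense_domain
  have hd₂ := h₂.dense_domain
  have hs₁ := LinearPMap.adjoint_isFormalAdjoint hd₁
  have hs₂ := LinearPMap.adjoint_isFormalAdjoint hd₂
  rw [LinearPMap.isSelfAdjoint_def.1 h₁] at hs₁
  rw [LinearPMap.isSelfAdjoint_def.1 h₂] at hs₂
  apply isSelfAdjoint_of_maximal
  · have h := (hd₁.prod hd₂).preimage (WithLp.homeomorphProd 2 H₁ H₂).isOpenMap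
    exact h
  · intro x y
    have e1 := hs₁ ⟨x.1.fst, x.2.1⟩ ⟨y.1.fst, y.2.1⟩
    have e2 := hs₂ ⟨x.1.snd, x.2.2⟩ ⟨y.1.snd, y.2.2⟩
    rw [WithLp.prod_inner_apply, WithLp.prod_inner_apply]
    exact congrArg₂ (· + ·) e1 e2
  · intro y w hyw
    constructor
    · rw [← LinearPMap.isSelfAdjoint_def.1 h₁]
      refine LinearPMap.mem_adjoint_domain_of_exists _ ⟨w.fst, fun x => ?_⟩
      have e := hyw ⟨WithLp.toLp 2 ((x : H₁), 0), x.2, D₂.domain.zero_mem⟩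
      rw [WithLp.prod_inner_apply, WithLp.prod_inner_apply] at e
      have e' : inner ℂ w.fst (x : H₁) + inner ℂ w.snd (0 : H₂) =
          inner ℂ y.fst (D₁ x) + inner ℂ y.snd (D₂ 0) := e
      rw [D₂.map_zero] at e'
      simpa using e'
    · rw [← LinearPMap.isSelfAdjoint_def.1 h₂]
      refine LinearPMap.mem_adjoint_domain_of_exists _ ⟨w.snd, fun x => ?_⟩
      have e := hyw ⟨WithLp.toLp 2 (0, (x : H₂)), D₁.domain.zero_mem, x.2⟩
      rw [WithLp.prod_inner_apply, WithLp.prod_inner_apply] at e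
      have e' : inner ℂ w.fst (0 : H₁) + inner ℂ w.snd (x : H₂) =
          inner ℂ y.fst (D₁ 0) + inner ℂ y.snd (D₂ x) := e
      rw [D₁.map_zero] at e'
      simpa using e'

/-- The unitary operator `U₁ ⊕ U₂` on the Hilbert space `H₁ ⊕ H₂`. -/
def directSumUnitary (U₁ : H₁ ≃ₗᵢ[ℂ] H₁) (U₂ : H₂ ≃ₗᵢ[ℂ] H₂) :
    WithLp 2 (H₁ × H₂) ≃ₗᵢ[ℂ] WithLp 2 (H₁ × H₂) where
  toLinearEquiv := (WithLp.linearEquiv 2 ℂ (H₁ × H₂)).trans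
    ((U₁.toLinearEquiv.prodCongr U₂.toLinearEquiv).trans
      (WithLp.linearEquiv 2 ℂ (H₁ × H₂)).symm)
  norm_map' := fun p => by
    rw [WithLp.prod_norm_eq_of_L2, WithLp.prod_norm_eq_of_L2]
    simp

/-- The direct sum of two quantum walks. -/
def QuantumWalk.directSum (W₁ : QuantumWalk H₁) (W₂ : QuantumWalk H₂) :
    QuantumWalk (WithLp 2 (H₁ × H₂)) where
  U := directSumUnitary W₁.U W₂.U
  D := directSumOp W₁.D W₂.D
  selfAdjoint := directSumOp_isSelfAdjoint W₁.selfAdjoint W₂.selfAdjoint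

end Walks

/-! ### Fourier analysis on `r ℤ` and its dual group -/

section Fourier

variable (r : ℝ)

/-- The group `r ℤ`. -/
abbrev Lattice : Type := AddSubgroup.zmultiples r

/-- The Hilbert space `ℓ²(r ℤ)`. -/
abbrev EllTwo : Type := lp (fun _ : Lattice r => ℂ) 2

/-- The dual group `𝕋 = ℝ / (2 π r⁻¹ ℤ)` of `r ℤ`. -/
abbrev Torus : Type := AddCircle (2 * Real.pi * r⁻¹)

/-- The diagonal operator `D_r`, `δ_x ↦ x δ_x`, on `ℓ²(r ℤ)`, with its maximal domain. -/
def diagOp : EllTwo r →ₗ.[ℂ] EllTwo r where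
  domain :=
    { carrier := {ξ | Memℓp (fun x : Lattice r => ((x : ℝ) : ℂ) * ξ x) 2}
      add_mem' := fun {a b} ha hb => by
        have h : (fun x : Lattice r => ((x : ℝ) : ℂ) * (a + b) x) =
            (fun x : Lattice r => ((x : ℝ) : ℂ) * a x) +
              fun x : Lattice r => ((x : ℝ) : ℂ) * b x := by
          funext x
          simp [mul_add]
        change Memℓp _ 2
        rw [h]
        exact Memℓp.add ha hb
      zero_mem' := by
        have h : (fun x : Lattice r => ((x : ℝ) : ℂ) * (0 : EllTwo r) x) = 0 := by
          funext x
          simp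
        change Memℓp _ 2
        rw [h]
        exact zero_memℓp
      smul_mem' := fun c a ha => by
        have h : (fun x : Lattice r => ((x : ℝ) : ℂ) * (c • a) x) =
            c • fun x : Lattice r => ((x : ℝ) : ℂ) * a x := by
          funext x
          simp [mul_left_comm]
        change Memℓp _ 2
        rw [h]
        exact Memℓp.const_smul ha c }
  toFun :=
    { toFun := fun ξ => ⟨fun x : Lattice r => ((x : ℝ) : ℂ) * ξ.1 x, ξ.2⟩
      map_add' := fun a b => by
        ext x
        exact mul_add _ _ _
      map_smul' := fun c a => by
        ext x
        exact mul_left_comm _ _ _ }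

theorem diagOp_apply (ξ : (diagOp r).domain) (x : Lattice r) :
    (diagOp r ξ) x = ((x : ℝ) : ℂ) * (ξ : EllTwo r) x := rfl

theorem single_mem_diagOp_domain (x : Lattice r) :
    lp.single 2 x (1 : ℂ) ∈ (diagOp r).domain := by
  have h : (fun y : Lattice r => ((y : ℝ) : ℂ) * (lp.single 2 x (1 : ℂ) : EllTwo r) y) =
      (((x : ℝ) : ℂ) • (lp.single 2 x (1 : ℂ) : EllTwo r) : EllTwo r) := by
    funext y
    rw [lp.coeFn_smul, Pi.smul_apply, smul_eq_mul]
    by_cases hy : y = x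
    · rw [hy]
    · simp [hy]
  change Memℓp _ 2
  rw [h]
  exact lp.memℓp _

theorem diagOp_isSelfAdjoint : IsSelfAdjoint (diagOp r) := by
  apply isSelfAdjoint_of_maximal
  · rw [Submodule.dense_iff_topologicalClosure_eq_top,
      Submodule.topologicalClosure_eq_top_iff, Submodule.eq_bot_iff]
    intro f hf
    ext x
    have h := (Submodule.mem_orthogonal _ _).1 hf _ (single_mem_diagOp_domain r x)
    rw [lp.inner_single_left] at h
    simpa using h
  · intro a b
    rw [lp.inner_eq_tsum, lp.inner_eq_tsum]
    refine tsum_congr fun x => ?_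
    rw [diagOp_apply, diagOp_apply]
    simp only [RCLike.inner_apply, map_mul, Complex.conj_ofReal]
    ring
  · intro y w hyw
    have h : (fun x : Lattice r => ((x : ℝ) : ℂ) * y x) = w := by
      funext x
      have e := hyw ⟨_, single_mem_diagOp_domain r x⟩
      have e' : diagOp r ⟨_, single_mem_diagOp_domain r x⟩ =
          lp.single 2 x ((x : ℝ) : ℂ) := by
        ext z
        rw [diagOp_apply]
        by_cases hz : z = x
        · subst hz
          simp
        · simp [hz]
      rw [e', lp.inner_single_right, lp.inner_single_right] at e
      have e2 := congrArg (starRingEnd ℂ) e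
      simpa [mul_comm] using e2.symm
    change Memℓp _ 2
    rw [h]
    exact lp.memℓp w

/-- The function `lam` on the torus is (real) analytic. -/
def IsAnalyticMap {r : ℝ} (lam : Torus r → Circle) : Prop :=
  AnalyticOnNhd ℝ (fun k : ℝ => ((lam (k : Torus r) : Circle) : ℂ)) Set.univ

/-- The function `lam` on the torus has no period other than `0`. -/
def IsPrimeMap {r : ℝ} (lam : Torus r → Circle) : Prop :=
  ∀ τ : Torus r, (∀ k : Torus r, lam (k + τ) = lam k) → τ = 0

theorem IsAnalyticMap.continuous {r : ℝ} {lam : Torus r → Circle} (h : IsAnalyticMap lam) :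
    Continuous fun k => (lam k : ℂ) := by
  have h1 : Continuous (fun k : ℝ => ((lam (k : Torus r) : Circle) : ℂ)) :=
    continuousOn_univ.1 h.continuousOn
  exact continuous_coinduced_dom.2 h1

variable [hr : Fact (0 < r)]

instance torusLengthPos : Fact (0 < 2 * Real.pi * r⁻¹) :=
  ⟨mul_pos Real.two_pi_pos (inv_pos.2 hr.out)⟩

/-- The Hilbert space `L²(𝕋)` for the normalized Haar measure. -/
abbrev LTwo : Type := Lp ℂ 2 (haarAddCircle (T := 2 * Real.pi * r⁻¹))

/-- The bijection `n ↦ n r` between `ℤ` and `r ℤ`. -/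
def latticeEquiv : ℤ ≃ Lattice r :=
  Equiv.ofBijective (fun n : ℤ => (⟨n • r, n, rfl⟩ : Lattice r))
    ⟨fun m n h => by
      have h' : m • r = n • r := congrArg Subtype.val h
      exact smul_left_injective ℤ hr.out.ne' h',
    fun x => by
      obtain ⟨n, hn⟩ := x.2
      exact ⟨n, Subtype.ext hn⟩⟩

/-- The character `c_x (k) = exp (i k x)` on the torus, for `x ∈ r ℤ`. -/
def character (x : Lattice r) : C(Torus r, ℂ) := fourier ((latticeEquiv r).symm x)

theorem character_coe (x : Lattice r) (k : ℝ) :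
    character r x (k : Torus r) = Complex.exp (Complex.I * k * (x : ℝ)) := by
  obtain ⟨n, rfl⟩ := (latticeEquiv r).surjective x
  rw [character, Equiv.symm_apply_apply, fourier_coe_apply]
  congr 1
  have h1 : (r : ℂ) ≠ 0 := by exact_mod_cast hr.out.ne'
  have h2 : (Real.pi : ℂ) ≠ 0 := by exact_mod_cast Real.pi_ne_zero
  have h3 : (((latticeEquiv r n : Lattice r) : ℝ) : ℂ) = n * r := by
    change ((n • r : ℝ) : ℂ) = n * r
    rw [zsmul_eq_mul]
    push_cast
    rfl
  rw [h3]
  push_cast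
  field_simp

theorem orthonormal_character : Orthonormal ℂ
    fun x : Lattice r => (ContinuousMap.toLp 2 haarAddCircle ℂ (character r x) : LTwo r) :=
  (orthonormal_fourier (T := 2 * Real.pi * r⁻¹)).comp _ (latticeEquiv r).symm.injective

theorem span_character : ⊤ ≤ (Submodule.span ℂ (Set.range fun x : Lattice r =>
    (ContinuousMap.toLp 2 haarAddCircle ℂ (character r x) : LTwo r))).topologicalClosure := by
  have h : Set.range (fun x : Lattice r =>
      (ContinuousMap.toLp 2 haarAddCircle ℂ (character r x) : LTwo r)) =
      Set.range (@fourierLp (2 * Real.pi * r⁻¹) _ 2 _) :=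
    (latticeEquiv r).symm.surjective.range_comp (@fourierLp (2 * Real.pi * r⁻¹) _ 2 _)
  rw [h]
  exact (span_fourierLp_closure_eq_top (by simp)).ge

/-- The orthonormal basis of `L²(𝕋)` that consists of the characters `c_x`, `x ∈ r ℤ`. -/
def characterBasis : HilbertBasis (Lattice r) ℂ (LTwo r) :=
  HilbertBasis.mk (orthonormal_character r) (span_character r)

/-- The Fourier transform `F_r : L²(𝕋) → ℓ²(r ℤ)`, which maps `c_x` to `δ_x`. -/
def fourierTransform : LTwo r ≃ₗᵢ[ℂ] EllTwo r := (characterBasis r).repr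

theorem fourierTransform_character (x : Lattice r) :
    fourierTransform r (ContinuousMap.toLp 2 haarAddCircle ℂ (character r x)) =
      lp.single 2 x (1 : ℂ) := by
  have h : (characterBasis r) x = ContinuousMap.toLp 2 haarAddCircle ℂ (character r x) := by
    rw [characterBasis, HilbertBasis.coe_mk]
  rw [← h]
  exact (characterBasis r).repr_self x

/-- The multiplication operator `M[ρ]` on `L²(𝕋)`, for a continuous function `ρ`. -/
def mulOp (ρ : C(Torus r, ℂ)) : LTwo r →L[ℂ] LTwo r :=
  (ContinuousLinearMap.mul ℂ ℂ).holderL haarAddCircle ∞ 2 2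
    (ContinuousMap.toLp ∞ haarAddCircle ℂ ρ)

theorem mulOp_ae (ρ : C(Torus r, ℂ)) (ξ : LTwo r) :
    mulOp r ρ ξ =ᵐ[haarAddCircle] fun k => ρ k * ξ k := by
  have h1 := ContinuousLinearMap.coeFn_holder (r := 2) (ContinuousLinearMap.mul ℂ ℂ)
    (ContinuousMap.toLp ∞ (haarAddCircle (T := 2 * Real.pi * r⁻¹)) ℂ ρ) ξ
  have h2 := ContinuousMap.coeFn_toLp (p := ∞) (𝕜 := ℂ)
    (haarAddCircle (T := 2 * Real.pi * r⁻¹)) ρ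
  filter_upwards [h1, h2] with k hk1 hk2
  rw [← hk2]
  exact hk1

theorem mulOp_mul (ρ σ : C(Torus r, ℂ)) (ξ : LTwo r) :
    mulOp r ρ (mulOp r σ ξ) = mulOp r (ρ * σ) ξ := by
  apply Lp.ext
  filter_upwards [mulOp_ae r ρ (mulOp r σ ξ), mulOp_ae r σ ξ, mulOp_ae r (ρ * σ) ξ]
    with k h1 h2 h3
  rw [h1, h2, h3]
  exact (mul_assoc _ _ _).symm

theorem mulOp_one (ξ : LTwo r) : mulOp r 1 ξ = ξ := by
  apply Lp.ext
  filter_upwards [mulOp_ae r 1 ξ] with k h1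
  rw [h1, ContinuousMap.one_apply, one_mul]

/-! ### Model quantum walks -/

variable {r}

/-- An analytic map from the torus to the unit circle, as a continuous complex function. -/
def IsAnalyticMap.toContinuousMap {lam : Torus r → Circle} (h : IsAnalyticMap lam) :
    C(Torus r, ℂ) := ⟨fun k => (lam k : ℂ), h.continuous⟩

theorem IsAnalyticMap.star_mul {lam : Torus r → Circle} (h : IsAnalyticMap lam) :
    star h.toContinuousMap * h.toContinuousMap = 1 := by
  ext k
  change (starRingEnd ℂ) (lam k : ℂ) * (lam k : ℂ) = 1
  rw [← Complex.normSq_eq_conj_mul_self, Circle.normSq_coe, Complex.ofReal_one]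

/-- The unitary operator `M[lam]` on `L²(𝕋)`. -/
def IsAnalyticMap.mulUnitary {lam : Torus r → Circle} (h : IsAnalyticMap lam) :
    LTwo r ≃ₗᵢ[ℂ] LTwo r where
  toFun := mulOp r h.toContinuousMap
  invFun := mulOp r (star h.toContinuousMap)
  map_add' := map_add _
  map_smul' := map_smul _
  left_inv := fun ξ => by rw [mulOp_mul, h.star_mul, mulOp_one]
  right_inv := fun ξ => by
    have e : h.toContinuousMap * star h.toContinuousMap = 1 :=
      (mul_comm _ _).trans h.star_mul
    rw [mulOp_mul, e, mulOp_one]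
  norm_map' := fun ξ => by
    change ‖mulOp r h.toContinuousMap ξ‖ = ‖ξ‖
    rw [Lp.norm_def, Lp.norm_def]
    congr 1
    refine eLpNorm_congr_norm_ae ?_
    filter_upwards [mulOp_ae r h.toContinuousMap ξ] with k hk
    rw [hk, norm_mul]
    change ‖(lam k : ℂ)‖ * _ = _
    rw [Circle.norm_coe, one_mul]

/-- The model quantum walk `(ℓ²(r ℤ), (F_r M[lam]^t F_r⁻¹)_t, D_r)`. -/
def modelWalk {lam : Torus r → Circle} (h : IsAnalyticMap lam) : QuantumWalk (EllTwo r) where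
  U := ((fourierTransform r).symm.trans h.mulUnitary).trans (fourierTransform r)
  D := diagOp r
  selfAdjoint := diagOp_isSelfAdjoint r

/-- The operator `F_r M[ρ] F_r⁻¹` on `ℓ²(r ℤ)`. -/
def fourierConj (ρ : C(Torus r, ℂ)) : EllTwo r →L[ℂ] EllTwo r :=
  ((fourierTransform r).toContinuousLinearEquiv : LTwo r →L[ℂ] EllTwo r) ∘L mulOp r ρ ∘L
    ((fourierTransform r).symm.toContinuousLinearEquiv : EllTwo r →L[ℂ] LTwo r)

end Fourier

end QW

end

/-! Under the Fourier transform `exp (i k D_r)` becomes translation by `k` on the torus. An element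
of the uniform commutant becomes an operator `X` on `L²(𝕋)` that commutes with `M[lam]` and whose
conjugates `flowConj r X k` depend continuously on `k` in norm. Each conjugate commutes with the
corresponding translate of `lam`.

Commutation with `M[lam]` alone still lets `X` connect points `p ≠ q` with `lam p = lam q`. If `lam
(p + k) ≠ lam (q + k)`, however, then `flowConj r X k` does not connect small neighbourhoods of `p`
and `q`, and for small `k` it is close to `X`. Such `k` exist arbitrarily close to `0`: otherwise
the analytic maps `k ↦ lam (p + k)` and `k ↦ lam (q + k)` agree near `0`, hence everywhere, and `q -
p` is a period. So `X` connects no two distinct points and commutes with all multiplication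
operators (`mulHom_mul_mul_eq_zero`, `commute_mulHom_of_separation`).

Averaging the conjugates of such an `X` over `0 ≤ k ≤ δ` multiplies the Fourier coefficients of `X
1` by factors of order `1 / x`. They become summable, so the average is multiplication by a
continuous function. As `δ → 0` the averages tend to `X` in norm, and these multiplication operators
form a closed set (`mem_range_mulHom_of_commute`).

For the second claim, a similarity to a direct sum pulls the projection onto the first summand back
to an element of the uniform commutant, that is, to a continuous idempotent function. The torus is
connected, so this function is `0` or `1`, and one summand is zero. -/

noncomputable section

namespace QW

/-! ### Continuous functions as multiplication operators on `L²(𝕋)` -/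

section Multiplication

variable (r : ℝ) [hr : Fact (0 < r)]

/-- The class in `L²(𝕋)` of a continuous function. -/
abbrev contToLTwo : C(Torus r, ℂ) →L[ℂ] LTwo r := ContinuousMap.toLp 2 haarAddCircle ℂ

theorem mulOp_contToLTwo (ρ a : C(Torus r, ℂ)) :
    mulOp r ρ (contToLTwo r a) = contToLTwo r (ρ * a) := by
  apply Lp.ext
  filter_upwards [mulOp_ae r ρ (contToLTwo r a),
    ContinuousMap.coeFn_toLp (p := 2) (𝕜 := ℂ) (haarAddCircle (T := 2 * Real.pi * r⁻¹)) a,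
    ContinuousMap.coeFn_toLp (p := 2) (𝕜 := ℂ) (haarAddCircle (T := 2 * Real.pi * r⁻¹)) (ρ * a)]
    with k h1 h2 h3
  rw [h1, h2, h3, ContinuousMap.mul_apply]

theorem mulOp_star (ρ : C(Torus r, ℂ)) : mulOp r (star ρ) = star (mulOp r ρ) := by
  rw [ContinuousLinearMap.star_eq_adjoint, ContinuousLinearMap.eq_adjoint_iff]
  intro f g
  rw [L2.inner_def, L2.inner_def]
  refine integral_congr_ae ?_
  filter_upwards [mulOp_ae r (star ρ) f, mulOp_ae r ρ g] with k h1 h2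
  rw [h1, h2]
  simp only [RCLike.inner_apply, map_mul, ContinuousMap.star_apply, RCLike.star_def,
    RCLike.conj_conj]
  ring

/-- The representation of continuous functions by multiplication operators. -/
def mulHom : C(Torus r, ℂ) →⋆ₐ[ℂ] (LTwo r →L[ℂ] LTwo r) where
  toFun := mulOp r
  map_one' := by
    ext1 ξ
    exact mulOp_one r ξ
  map_mul' a b := by
    ext1 ξ
    exact (mulOp_mul r a b ξ).symm
  map_zero' := by simp [mulOp]
  map_add' a b := by simp [mulOp]
  commutes' c := by
    ext1 ξ
    have h : algebraMap ℂ C(Torus r, ℂ) c = c • 1 := Algebra.algebraMap_eq_smul_one c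
    have h' : mulOp r (c • (1 : C(Torus r, ℂ))) = c • mulOp r 1 := by simp [mulOp]
    rw [h, h', Algebra.algebraMap_eq_smul_one, smul_apply, mulOp_one]
    rfl
  map_star' := mulOp_star r

theorem mulHom_contToLTwo (ρ a : C(Torus r, ℂ)) :
    mulHom r ρ (contToLTwo r a) = contToLTwo r (ρ * a) := mulOp_contToLTwo r ρ a

/-- Evaluation at the constant `1` recovers the function, because Haar measure charges every
non-empty open set. -/
theorem mulHom_injective : Function.Injective (mulHom r) := by
  intro a b hab
  have h := congrArg (fun T : LTwo r →L[ℂ] LTwo r => T (contToLTwo r 1)) hab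
  simp only [mulHom_contToLTwo, mul_one] at h
  exact ContinuousMap.toLp_injective (haarAddCircle (T := 2 * Real.pi * r⁻¹)) h

theorem mulHom_isometry : Isometry (mulHom r) :=
  NonUnitalStarAlgHom.isometry (mulHom r) (mulHom_injective r)

theorem continuous_mulHom : Continuous (mulHom r) := (mulHom_isometry r).continuous

/-- An injective star homomorphism of C⋆-algebras is isometric, so its range is complete. -/
theorem isClosed_range_mulHom : IsClosed (Set.range (mulHom r)) :=
  (mulHom_isometry r).isClosedEmbedding.isClosed_range

theorem denseRange_contToLTwo : DenseRange (contToLTwo r) :=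
  ContinuousMap.toLp_denseRange ℂ _ ℂ (by simp)

/-- An operator that commutes with all multiplication operators is determined by its value at the
constant function `1`. -/
theorem eq_mulHom_of_commute {X : LTwo r →L[ℂ] LTwo r} (hX : ∀ a, Commute X (mulHom r a))
    {ρ : C(Torus r, ℂ)} (h1 : X (contToLTwo r 1) = contToLTwo r ρ) : X = mulHom r ρ := by
  have h : ⇑X = mulHom r ρ := by
    refine DenseRange.equalizer (denseRange_contToLTwo r) X.continuous
      (mulHom r ρ).continuous ?_
    funext a
    have h2 : X (mulHom r a (contToLTwo r 1)) = mulHom r a (X (contToLTwo r 1)) :=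
      congrArg (fun T : LTwo r →L[ℂ] LTwo r => T (contToLTwo r 1)) (hX a).eq
    rw [h1, mulHom_contToLTwo, mulHom_contToLTwo, mul_one] at h2
    simp only [Function.comp_apply]
    rw [h2, mulHom_contToLTwo, mul_comm a ρ]
  exact ContinuousLinearMap.ext fun ξ => congrFun h ξ

end Multiplication

/-! ### The unitary group generated by `D_r` -/

section Diagonal

variable (r : ℝ)

/-- The number `exp (i k x)`. -/
def phase (k x : ℝ) : ℂ := Complex.exp (Complex.I * k * x)

theorem norm_phase (k x : ℝ) : ‖phase k x‖ = 1 := by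
  have h : Complex.I * k * x = ((k * x : ℝ) : ℂ) * Complex.I := by push_cast; ring
  rw [phase, h, Complex.norm_exp_ofReal_mul_I]

theorem phase_zero (x : ℝ) : phase 0 x = 1 := by simp [phase]

theorem phase_add (s t x : ℝ) : phase (s + t) x = phase s x * phase t x := by
  rw [phase, phase, phase, ← Complex.exp_add]
  congr 1
  push_cast
  ring

theorem hasDerivAt_phase (k x : ℝ) :
    HasDerivAt (fun s : ℝ => phase s x) (Complex.I * x * phase k x) k := by
  have h1 : HasDerivAt (fun s : ℝ => Complex.I * (s : ℂ) * x) (Complex.I * 1 * x) k :=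
    ((Complex.ofRealCLM.hasDerivAt (x := k)).const_mul Complex.I).mul_const (x : ℂ)
  have h2 := h1.cexp
  rw [mul_one] at h2
  rw [mul_comm]
  exact h2

theorem continuous_phase (x : ℝ) : Continuous fun s : ℝ => phase s x :=
  continuous_iff_continuousAt.2 fun k => (hasDerivAt_phase k x).continuousAt

variable {r} in
theorem memℓp_phase_mul (k : ℝ) (ξ : EllTwo r) :
    Memℓp (fun x : Lattice r => phase k x * ξ x) 2 := by
  have h := lp.memℓp ξ
  rw [memℓp_gen_iff (by simp)] at h ⊢
  simpa only [norm_mul, norm_phase, one_mul] using h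

/-- Multiplication of a sequence by the phases `exp (i k x)`. -/
def phaseMul (k : ℝ) (ξ : EllTwo r) : EllTwo r := ⟨_, memℓp_phase_mul k ξ⟩

theorem phaseMul_apply (k : ℝ) (ξ : EllTwo r) (x : Lattice r) :
    phaseMul r k ξ x = phase k x * ξ x := rfl

/-- The unitary operator of multiplication by the phases `exp (i k x)`. -/
def phaseUnitary (k : ℝ) : EllTwo r ≃ₗᵢ[ℂ] EllTwo r where
  toFun := phaseMul r k
  invFun := phaseMul r (-k)
  map_add' ξ η := by
    ext x
    exact mul_add _ _ _
  map_smul' c ξ := by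
    ext x
    exact mul_left_comm _ _ _
  left_inv ξ := by
    ext x
    rw [phaseMul_apply, phaseMul_apply, ← mul_assoc, ← phase_add, neg_add_cancel, phase_zero,
      one_mul]
  right_inv ξ := by
    ext x
    rw [phaseMul_apply, phaseMul_apply, ← mul_assoc, ← phase_add, add_neg_cancel, phase_zero,
      one_mul]
  norm_map' ξ := by
    change ‖phaseMul r k ξ‖ = ‖ξ‖
    rw [lp.norm_eq_tsum_rpow (by simp), lp.norm_eq_tsum_rpow (by simp)]
    simp only [phaseMul_apply, norm_mul, norm_phase, one_mul]

theorem phaseUnitary_apply (k : ℝ) (ξ : EllTwo r) (x : Lattice r) :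
    phaseUnitary r k ξ x = phase k x * ξ x := rfl

theorem phaseUnitary_single (k : ℝ) (x : Lattice r) (c : ℂ) :
    phaseUnitary r k (lp.single 2 x c) = phase k x • lp.single 2 x c := by
  ext y
  rw [phaseUnitary_apply, lp.coeFn_smul, Pi.smul_apply, smul_eq_mul]
  by_cases hy : y = x
  · rw [hy]
  · simp [hy]

theorem continuous_phaseUnitary (ξ : EllTwo r) : Continuous fun k : ℝ => phaseUnitary r k ξ := by
  rw [continuous_iff_continuousAt]
  intro k₀
  -- Two phases differ by at most `2`, so this series dominates the squared distance of two points
  -- of the orbit.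
  have hs : Summable fun x : Lattice r => 4 * ‖ξ x‖ ^ 2 := by
    have h := (lp.memℓp ξ).summable (by simp)
    simp only [ENNReal.toReal_ofNat, Real.rpow_ofNat] at h
    exact h.mul_left 4
  have hc : Continuous fun k : ℝ => ∑' x : Lattice r, ‖(phase k x - phase k₀ x) * ξ x‖ ^ 2 := by
    refine continuous_tsum (fun x => ?_) hs fun x k => ?_
    · exact (((continuous_phase _).sub continuous_const).mul continuous_const).norm.pow 2
    · have h1 : ‖phase k x - phase k₀ x‖ ≤ 2 := by
        refine (norm_sub_le _ _).trans ?_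
        rw [norm_phase, norm_phase]
        norm_num
      rw [norm_mul, mul_pow, norm_mul, norm_pow, norm_pow, norm_norm, norm_norm]
      gcongr
      nlinarith [norm_nonneg (phase k x - phase k₀ x)]
  have hn : ∀ k, ‖phaseUnitary r k ξ - phaseUnitary r k₀ ξ‖ ^ 2 =
      ∑' x : Lattice r, ‖(phase k x - phase k₀ x) * ξ x‖ ^ 2 := by
    intro k
    have h := lp.norm_rpow_eq_tsum (p := 2) (by simp) (phaseUnitary r k ξ - phaseUnitary r k₀ ξ)
    simp only [ENNReal.toReal_ofNat, Real.rpow_ofNat] at h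
    rw [h]
    refine tsum_congr fun x => ?_
    rw [lp.coeFn_sub, Pi.sub_apply, phaseUnitary_apply, phaseUnitary_apply, sub_mul]
  have h0 := hc.tendsto k₀
  simp only [sub_self, zero_mul, norm_zero, ne_eq, OfNat.ofNat_ne_zero, not_false_eq_true,
    zero_pow, tsum_zero] at h0
  simp only [← hn] at h0
  rw [ContinuousAt, tendsto_iff_norm_sub_tendsto_zero]
  have h1 := (Real.continuous_sqrt.tendsto 0).comp h0
  simpa [Function.comp_def, Real.sqrt_sq] using h1

/-- The integrated Schrödinger equation, checked coordinatewise. Differentiability of the orbit in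
norm then follows from continuity of the integrand, without an estimate of difference quotients. -/
theorem phaseUnitary_integral {ξ η : EllTwo r} (h : ∀ x : Lattice r, ((x : ℝ) : ℂ) * ξ x = η x)
    (k : ℝ) : phaseUnitary r k ξ =
      ξ + ∫ s in (0 : ℝ)..k, phaseUnitary r s (Complex.I • η) := by
  ext x
  have hc := continuous_phaseUnitary r (Complex.I • η)
  have h1 := ContinuousLinearMap.intervalIntegral_comp_comm
    (lp.evalCLM ℂ (fun _ : Lattice r => ℂ) 2 x) (hc.intervalIntegrable (μ := volume) 0 k)
  have h2 : ∫ s in (0 : ℝ)..k, phaseUnitary r s (Complex.I • η) x =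
      (∫ s in (0 : ℝ)..k, phaseUnitary r s (Complex.I • η)) x := h1
  rw [lp.coeFn_add, Pi.add_apply, ← h2, phaseUnitary_apply]
  have h3 : ∀ s : ℝ, HasDerivAt (fun s : ℝ => phase s x * ξ x)
      (phaseUnitary r s (Complex.I • η) x) s := by
    intro s
    have h4 := (hasDerivAt_phase s x).mul_const (ξ x)
    have h5 : phaseUnitary r s (Complex.I • η) x = Complex.I * x * phase s x * ξ x := by
      rw [phaseUnitary_apply, lp.coeFn_smul, Pi.smul_apply, smul_eq_mul, ← h]
      ring
    rw [h5]
    exact h4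
  rw [intervalIntegral.integral_eq_sub_of_hasDerivAt (fun s _ => h3 s)]
  · rw [phase_zero]
    ring
  · have h5 : Continuous fun s => phaseUnitary r s (Complex.I • η) x :=
      (lp.evalCLM ℂ (fun _ : Lattice r => ℂ) 2 x).continuous.comp hc
    exact h5.intervalIntegrable _ _

theorem mem_graph_diagOp_iff (ξ η : EllTwo r) :
    (ξ, η) ∈ (diagOp r).graph ↔ ∀ x : Lattice r, ((x : ℝ) : ℂ) * ξ x = η x := by
  rw [LinearPMap.mem_graph_iff]
  constructor
  · rintro ⟨ζ, h1, h2⟩ x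
    have h1' : (ζ : EllTwo r) = ξ := h1
    have h2' : diagOp r ζ = η := h2
    rw [← h1', ← h2', diagOp_apply]
  · intro h
    have hm : ξ ∈ (diagOp r).domain := by
      have e : (fun x : Lattice r => ((x : ℝ) : ℂ) * ξ x) = η := funext h
      change Memℓp _ 2
      rw [e]
      exact lp.memℓp η
    refine ⟨⟨ξ, hm⟩, rfl, ?_⟩
    ext x
    exact h x

theorem isUnitaryGroupOf_phaseUnitary : IsUnitaryGroupOf (diagOp r) (phaseUnitary r) where
  zero := by
    ext ξ x
    rw [phaseUnitary_apply, phase_zero, one_mul]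
    rfl
  add s t := by
    ext ξ x
    change _ = phaseUnitary r s (phaseUnitary r t ξ) x
    rw [phaseUnitary_apply, phaseUnitary_apply, phaseUnitary_apply, phase_add, mul_assoc]
  cont := continuous_phaseUnitary r
  gen ξ η := by
    rw [mem_graph_diagOp_iff]
    constructor
    · intro h
      have hc := continuous_phaseUnitary r (Complex.I • η)
      have h1 := (intervalIntegral.integral_hasDerivAt_right (hc.intervalIntegrable 0 0)
        hc.stronglyMeasurable.stronglyMeasurableAtFilter hc.continuousAt).const_add ξ
      have h2 : phaseUnitary r 0 (Complex.I • η) = Complex.I • η := by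
        ext x
        rw [phaseUnitary_apply, phase_zero, one_mul]
      rw [h2] at h1
      exact h1.congr_of_eventuallyEq
        (Filter.Eventually.of_forall fun k => phaseUnitary_integral r h k)
    · intro h x
      have h1 := ((lp.evalCLM ℂ (fun _ : Lattice r => ℂ) 2 x).restrictScalars ℝ).hasFDerivAt
        |>.comp_hasDerivAt (0 : ℝ) h
      have h2 := (hasDerivAt_phase 0 x).mul_const (ξ x)
      have h3 := h1.unique h2
      rw [phase_zero, mul_one] at h3
      have h4 : Complex.I * η x = Complex.I * x * ξ x := h3
      rw [mul_assoc] at h4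
      exact (mul_left_cancel₀ Complex.I_ne_zero h4).symm

theorem expI_eq_of_isUnitaryGroupOf {H : Type*} [NormedAddCommGroup H] [InnerProductSpace ℂ H]
    [CompleteSpace H] {D : H →ₗ.[ℂ] H} (hD : IsSelfAdjoint D) {W : ℝ → (H ≃ₗᵢ[ℂ] H)}
    (hW : IsUnitaryGroupOf D W) (k : ℝ) :
    expI D k = ((W k).toContinuousLinearEquiv : H →L[ℂ] H) := by
  have h : ∃ W : ℝ → (H ≃ₗᵢ[ℂ] H), IsUnitaryGroupOf D W := ⟨W, hW⟩
  rw [expI, dif_pos h, h.choose_spec.unique hD hW]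

theorem expI_diagOp (k : ℝ) (ξ : EllTwo r) : expI (diagOp r) k ξ = phaseUnitary r k ξ := by
  rw [expI_eq_of_isUnitaryGroupOf (diagOp_isSelfAdjoint r) (isUnitaryGroupOf_phaseUnitary r)]
  rfl

end Diagonal

/-! ### The group of `D_r` as translation on the torus -/

section Flow

variable (r : ℝ)

/-- Translation of a continuous function on the torus, `p ↦ a (p + k)`. -/
def translate (k : ℝ) : C(Torus r, ℂ) →L[ℂ] C(Torus r, ℂ) where
  toFun a := a.comp ⟨fun p => p + (k : Torus r), continuous_add_const _⟩
  map_add' _ _ := rfl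
  map_smul' _ _ := rfl
  cont := ContinuousMap.continuous_precomp _

theorem translate_apply (k : ℝ) (a : C(Torus r, ℂ)) (p : Torus r) :
    translate r k a p = a (p + (k : Torus r)) := rfl

theorem translate_mul (k : ℝ) (a b : C(Torus r, ℂ)) :
    translate r k (a * b) = translate r k a * translate r k b := rfl

theorem translate_one (k : ℝ) : translate r k 1 = 1 := rfl

theorem continuous_translate (a : C(Torus r, ℂ)) : Continuous fun k : ℝ => translate r k a := by
  refine ContinuousMap.continuous_of_continuous_uncurry _ ?_
  change Continuous fun z : ℝ × Torus r => a (z.2 + (z.1 : Torus r))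
  exact a.continuous.comp (continuous_snd.add
    ((AddCircle.continuous_mk' (2 * Real.pi * r⁻¹)).comp continuous_fst))

variable [hr : Fact (0 < r)]

theorem translate_character (k : ℝ) (x : Lattice r) :
    translate r k (character r x) = phase k x • character r x := by
  ext p
  induction p using QuotientAddGroup.induction_on with
  | H p =>
    change character r x ((p : Torus r) + (k : Torus r)) = phase k x * character r x (p : Torus r)
    rw [← AddCircle.coe_add, character_coe, character_coe, phase, ← Complex.exp_add]
    congr 1
    push_cast
    ring

theorem dense_span_character :
    Dense (Submodule.span ℂ (Set.range (character r)) : Set C(Torus r, ℂ)) := by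
  have h : Set.range (character r) = Set.range (@fourier (2 * Real.pi * r⁻¹)) :=
    (latticeEquiv r).symm.surjective.range_comp (@fourier (2 * Real.pi * r⁻¹))
  rw [h, Submodule.dense_iff_topologicalClosure_eq_top]
  exact span_fourier_closure_eq_top

/-- The unitary group `F_r⁻¹ exp (i k D_r) F_r` on `L²(𝕋)`. -/
def flow (k : ℝ) : LTwo r ≃ₗᵢ[ℂ] LTwo r :=
  ((fourierTransform r).trans (phaseUnitary r k)).trans (fourierTransform r).symm

/-- The operator `flow r k`, as a bounded operator. -/
abbrev flowL (k : ℝ) : LTwo r →L[ℂ] LTwo r := ((flow r k).toContinuousLinearEquiv : _ →L[ℂ] _)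

theorem fourierTransform_flow (k : ℝ) (f : LTwo r) :
    fourierTransform r (flow r k f) = phaseUnitary r k (fourierTransform r f) :=
  (fourierTransform r).apply_symm_apply _

theorem flow_add (s t : ℝ) (f : LTwo r) : flow r (s + t) f = flow r s (flow r t f) := by
  apply (fourierTransform r).injective
  rw [fourierTransform_flow, fourierTransform_flow, fourierTransform_flow,
    (isUnitaryGroupOf_phaseUnitary r).add]
  rfl

theorem flow_zero (f : LTwo r) : flow r 0 f = f := by
  apply (fourierTransform r).injective
  rw [fourierTransform_flow, (isUnitaryGroupOf_phaseUnitary r).zero]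
  rfl

theorem flow_flow_neg (k : ℝ) (f : LTwo r) : flow r k (flow r (-k) f) = f := by
  rw [← flow_add, add_neg_cancel, flow_zero]

theorem flow_neg_flow (k : ℝ) (f : LTwo r) : flow r (-k) (flow r k f) = f := by
  rw [← flow_add, neg_add_cancel, flow_zero]

/-- Both sides are continuous and linear in `a`, and on a character both multiply by the same phase.
-/
theorem flow_contToLTwo (k : ℝ) (a : C(Torus r, ℂ)) :
    flow r k (contToLTwo r a) = contToLTwo r (translate r k a) := by
  have h : flowL r k ∘L contToLTwo r = contToLTwo r ∘L translate r k := by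
    refine ContinuousLinearMap.ext_on (dense_span_character r) ?_
    rintro _ ⟨x, rfl⟩
    change flow r k (contToLTwo r (character r x)) = contToLTwo r (translate r k (character r x))
    apply (fourierTransform r).injective
    rw [fourierTransform_flow, translate_character, map_smul, map_smul,
      fourierTransform_character, phaseUnitary_single]
  exact congrArg (fun T : C(Torus r, ℂ) →L[ℂ] LTwo r => T a) h

theorem flow_mulHom (k : ℝ) (a : C(Torus r, ℂ)) (f : LTwo r) :
    flow r k (mulHom r a f) = mulHom r (translate r k a) (flow r k f) := by
  induction f using (denseRange_contToLTwo r).induction_on with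
  | ih b =>
    rw [mulHom_contToLTwo, flow_contToLTwo, flow_contToLTwo, mulHom_contToLTwo, translate_mul]
  | hp =>
    exact isClosed_eq ((flow r k).continuous.comp (mulHom r a).continuous)
      ((mulHom r (translate r k a)).continuous.comp (flow r k).continuous)

/-- The operator `flow k ∘ X ∘ flow (-k)`. -/
def flowConj (X : LTwo r →L[ℂ] LTwo r) (k : ℝ) : LTwo r →L[ℂ] LTwo r :=
  flowL r k ∘L X ∘L flowL r (-k)

theorem flowConj_apply (X : LTwo r →L[ℂ] LTwo r) (k : ℝ) (f : LTwo r) :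
    flowConj r X k f = flow r k (X (flow r (-k) f)) := rfl

theorem flowConj_zero (X : LTwo r →L[ℂ] LTwo r) : flowConj r X 0 = X := by
  ext1 f
  rw [flowConj_apply, neg_zero, flow_zero, flow_zero]

theorem flowConj_mulHom (a : C(Torus r, ℂ)) (k : ℝ) :
    flowConj r (mulHom r a) k = mulHom r (translate r k a) := by
  ext1 f
  rw [flowConj_apply, flow_mulHom, flow_flow_neg]

theorem flowConj_comp (X Y : LTwo r →L[ℂ] LTwo r) (k : ℝ) :
    flowConj r (X * Y) k = flowConj r X k * flowConj r Y k := by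
  ext1 f
  change flow r k (X (Y (flow r (-k) f))) = flow r k (X (flow r (-k) (flow r k (Y (flow r (-k) f)))))
  rw [flow_neg_flow]

/-- Conjugation by the flow is multiplicative and translates symbols. This trades commutation with
one function for commutation of nearby operators with its translates. -/
theorem commute_flowConj {X : LTwo r →L[ℂ] LTwo r} {a : C(Torus r, ℂ)}
    (h : Commute X (mulHom r a)) (k : ℝ) :
    Commute (flowConj r X k) (mulHom r (translate r k a)) := by
  rw [← flowConj_mulHom, Commute, SemiconjBy, ← flowConj_comp, ← flowConj_comp, h.eq]

/-- Conjugation of an operator on `ℓ²(r ℤ)` by the Fourier transform. -/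
def fourierPull (X : EllTwo r →L[ℂ] EllTwo r) : LTwo r →L[ℂ] LTwo r :=
  ((fourierTransform r).symm.toContinuousLinearEquiv : EllTwo r →L[ℂ] LTwo r) ∘L X ∘L
    ((fourierTransform r).toContinuousLinearEquiv : LTwo r →L[ℂ] EllTwo r)

theorem fourierPull_apply (X : EllTwo r →L[ℂ] EllTwo r) (f : LTwo r) :
    fourierPull r X f = (fourierTransform r).symm (X (fourierTransform r f)) := rfl

theorem fourierConj_apply (ρ : C(Torus r, ℂ)) (ξ : EllTwo r) :
    fourierConj ρ ξ = fourierTransform r (mulHom r ρ ((fourierTransform r).symm ξ)) := rfl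

theorem fourierPull_eq_mulHom_iff (X : EllTwo r →L[ℂ] EllTwo r) (ρ : C(Torus r, ℂ)) :
    fourierPull r X = mulHom r ρ ↔ X = fourierConj ρ := by
  constructor
  · intro h
    ext1 ξ
    rw [fourierConj_apply, ← h, fourierPull_apply, LinearIsometryEquiv.apply_symm_apply,
      LinearIsometryEquiv.apply_symm_apply]
  · rintro rfl
    ext1 f
    rw [fourierPull_apply, fourierConj_apply, LinearIsometryEquiv.symm_apply_apply,
      LinearIsometryEquiv.symm_apply_apply]

theorem flowConj_fourierPull (X : EllTwo r →L[ℂ] EllTwo r) (k : ℝ) :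
    flowConj r (fourierPull r X) k = fourierPull r (conjFlow (diagOp r) (diagOp r) X k) := by
  ext1 f
  apply (fourierTransform r).injective
  rw [flowConj_apply, fourierTransform_flow, fourierPull_apply, fourierPull_apply,
    LinearIsometryEquiv.apply_symm_apply, LinearIsometryEquiv.apply_symm_apply,
    fourierTransform_flow]
  change _ = expI (diagOp r) k (X (expI (diagOp r) (-k) (fourierTransform r f)))
  rw [expI_diagOp, expI_diagOp]

theorem conjFlow_fourierConj (ρ : C(Torus r, ℂ)) (k : ℝ) :
    conjFlow (diagOp r) (diagOp r) (fourierConj ρ) k = fourierConj (translate r k ρ) := by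
  rw [← fourierPull_eq_mulHom_iff, ← flowConj_fourierPull,
    (fourierPull_eq_mulHom_iff r _ ρ).2 rfl, flowConj_mulHom]

theorem continuous_fourierConj : Continuous fun ρ : C(Torus r, ℂ) => fourierConj ρ := by
  have h := ((continuous_mulHom r).clm_comp (continuous_const (y :=
    ((fourierTransform r).symm.toContinuousLinearEquiv : EllTwo r →L[ℂ] LTwo r))))
  exact (continuous_const (y :=
    ((fourierTransform r).toContinuousLinearEquiv : LTwo r →L[ℂ] EllTwo r))).clm_comp h

theorem continuous_fourierPull : Continuous (fourierPull r) := by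
  have h := (continuous_id (X := EllTwo r →L[ℂ] EllTwo r)).clm_comp (continuous_const (y :=
    ((fourierTransform r).toContinuousLinearEquiv : LTwo r →L[ℂ] EllTwo r)))
  exact (continuous_const (y :=
    ((fourierTransform r).symm.toContinuousLinearEquiv : EllTwo r →L[ℂ] LTwo r))).clm_comp h

theorem isUniformOp_fourierConj (ρ : C(Torus r, ℂ)) :
    IsUniformOp (diagOp r) (diagOp r) (fourierConj ρ) := by
  have h : conjFlow (diagOp r) (diagOp r) (fourierConj ρ) =
      fun k => fourierConj (translate r k ρ) := funext (conjFlow_fourierConj r ρ)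
  rw [IsUniformOp, h]
  exact (continuous_fourierConj r).comp (continuous_translate r ρ)

theorem IsUniformOp.continuous_flowConj {X : EllTwo r →L[ℂ] EllTwo r}
    (hX : IsUniformOp (diagOp r) (diagOp r) X) : Continuous (flowConj r (fourierPull r X)) := by
  have h : flowConj r (fourierPull r X) =
      fun k => fourierPull r (conjFlow (diagOp r) (diagOp r) X k) :=
    funext (flowConj_fourierPull r X)
  rw [h]
  exact (continuous_fourierPull r).comp hX

end Flow

/-! ### Consequences of commuting with one unimodular function -/

section Localization

/-- If `∑ Aᵢ² = 1` with self-adjoint operators `Aᵢ` that commute with `X`, then a bound on the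
blocks `⟨Aᵢ f, X Aᵢ g⟩` gives a bound on `⟨f, X g⟩`. -/
theorem norm_inner_le_of_blocks {H ι : Type*} [NormedAddCommGroup H] [InnerProductSpace ℂ H]
    [CompleteSpace H] [Fintype ι] {X : H →L[ℂ] H} {A : ι → (H →L[ℂ] H)}
    (hA : ∀ i, IsSelfAdjoint (A i)) (hsum : ∑ i, A i * A i = 1) (hX : ∀ i, Commute X (A i))
    {ε : ℝ} (hε : 0 ≤ ε) (f g : H)
    (hb : ∀ i, ‖inner ℂ (A i f) (X (A i g))‖ ≤ ε * (‖A i f‖ * ‖A i g‖)) :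
    ‖inner ℂ f (X g)‖ ≤ ε * (‖f‖ * ‖g‖) := by
  have hadj : ∀ i (x y : H), inner ℂ (A i x) y = inner ℂ x (A i y) := by
    intro i x y
    rw [← ContinuousLinearMap.adjoint_inner_right, (hA i).adjoint_eq]
  have hexp : ∀ x : H, ∑ i, A i (A i x) = x := by
    intro x
    have h := congrArg (fun T : H →L[ℂ] H => T x) hsum
    simpa [sum_apply] using h
  have hsq : ∀ x : H, ∑ i, ‖A i x‖ ^ 2 = ‖x‖ ^ 2 := by
    intro x
    have e : ∀ y : H, ((‖y‖ ^ 2 : ℝ) : ℂ) = inner ℂ y y := by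
      intro y
      rw [inner_self_eq_norm_sq_to_K]
      push_cast
      rfl
    have h : ((∑ i, ‖A i x‖ ^ 2 : ℝ) : ℂ) = ((‖x‖ ^ 2 : ℝ) : ℂ) := by
      rw [Complex.ofReal_sum, e]
      nth_rewrite 3 [← hexp x]
      rw [inner_sum]
      refine Finset.sum_congr rfl fun i _ => ?_
      rw [e, hadj]
    exact_mod_cast h
  -- One factor `A i` passes through `X` to the left entry, so only diagonal blocks occur and the
  -- final bound does not depend on the number of blocks.
  have hin : inner ℂ f (X g) = ∑ i, inner ℂ (A i f) (X (A i g)) := by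
    nth_rewrite 1 [← hexp g]
    rw [map_sum, inner_sum]
    refine Finset.sum_congr rfl fun i _ => ?_
    have h := congrArg (fun T : H →L[ℂ] H => T (A i g)) (hX i).eq
    have h' : X (A i (A i g)) = A i (X (A i g)) := h
    rw [h', hadj]
  rw [hin]
  calc ‖∑ i, inner ℂ (A i f) (X (A i g))‖ ≤ ∑ i, ε * (‖A i f‖ * ‖A i g‖) :=
        (norm_sum_le _ _).trans (Finset.sum_le_sum fun i _ => hb i)
    _ = ε * ∑ i, ‖A i f‖ * ‖A i g‖ := by rw [Finset.mul_sum]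
    _ ≤ ε * (√(∑ i, ‖A i f‖ ^ 2) * √(∑ i, ‖A i g‖ ^ 2)) := by
        gcongr
        exact Real.sum_mul_le_sqrt_mul_sqrt _ _ _
    _ = ε * (‖f‖ * ‖g‖) := by
        rw [hsq, hsq, Real.sqrt_sq (norm_nonneg _), Real.sqrt_sq (norm_nonneg _)]

variable {r : ℝ} [hr : Fact (0 < r)]

/-- An operator that commutes with multiplication by a unimodular function commutes with
multiplication by every continuous function of it. -/
theorem commute_mulHom_comp {X : LTwo r →L[ℂ] LTwo r} {μ : C(Torus r, ℂ)} (hμ : ∀ p, ‖μ p‖ = 1)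
    (hX : Commute X (mulHom r μ)) (u : C(ℂ, ℂ)) : Commute X (mulHom r (u.comp μ)) := by
  have hmem : ∀ p, μ p ∈ Metric.sphere (0 : ℂ) 1 := fun p => by simpa using hμ p
  set ν : C(Torus r, Metric.sphere (0 : ℂ) 1) :=
    ⟨fun p => ⟨μ p, hmem p⟩, μ.continuous.subtype_mk _⟩
  -- Since `|μ| = 1`, the conjugate of `μ` is its inverse, and what commutes with an invertible
  -- element commutes with its inverse.
  have hstar : Commute X (mulHom r (star μ)) := by
    have h1 : star μ * μ = 1 := by
      ext p
      change (starRingEnd ℂ) (μ p) * μ p = 1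
      rw [← Complex.normSq_eq_conj_mul_self, Complex.normSq_eq_norm_sq, hμ]
      simp
    have h2 : mulHom r (star μ) * mulHom r μ = 1 := by rw [← map_mul, h1, map_one]
    have h3 : mulHom r μ * mulHom r (star μ) = 1 := by
      rw [← map_mul, mul_comm μ (star μ), h1, map_one]
    rw [Commute, SemiconjBy]
    calc X * mulHom r (star μ) = mulHom r (star μ) * (mulHom r μ * X) * mulHom r (star μ) := by
          rw [← mul_assoc, h2, one_mul]
      _ = mulHom r (star μ) * X * (mulHom r μ * mulHom r (star μ)) := by
          rw [← hX.eq]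
          simp only [mul_assoc]
      _ = mulHom r (star μ) * X := by rw [h3, mul_one]
  -- Stone–Weierstrass on the circle: the admissible `v` form a closed subalgebra that contains the
  -- coordinate and its conjugate.
  have key : ∀ v : C(Metric.sphere (0 : ℂ) 1, ℂ), Commute X (mulHom r (v.comp ν)) := by
    intro v
    induction v using ContinuousMap.induction_on_of_compact with
    | const c =>
      have h : (ContinuousMap.const (Metric.sphere (0 : ℂ) 1) c).comp ν =
        algebraMap ℂ C(Torus r, ℂ) c := rfl
      rw [h, AlgHomClass.commutes]
      exact (Algebra.commutes c X).symm
    | id => exact hX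
    | star_id => exact hstar
    | add v w hv hw =>
      have h : (v + w).comp ν = v.comp ν + w.comp ν := rfl
      rw [h, map_add]
      exact hv.add_right hw
    | mul v w hv hw =>
      have h : (v * w).comp ν = v.comp ν * w.comp ν := rfl
      rw [h, map_mul]
      exact hv.mul_right hw
    | frequently v hv =>
      have hc : Continuous fun v : C(Metric.sphere (0 : ℂ) 1, ℂ) => mulHom r (v.comp ν) :=
        (continuous_mulHom r).comp (ContinuousMap.continuous_precomp ν)
      have hcl : IsClosed {v : C(Metric.sphere (0 : ℂ) 1, ℂ) | Commute X (mulHom r (v.comp ν))} :=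
        isClosed_eq (continuous_const.mul hc) (hc.mul continuous_const)
      exact hcl.closure_subset (mem_closure_iff_frequently.2 hv)
  exact key (u.comp ⟨Subtype.val, continuous_subtype_val⟩)

/-- An operator that commutes with multiplication by a unimodular function vanishes between
closed sets with disjoint images. -/
theorem mulHom_mul_mul_eq_zero_of_disjoint_image {X : LTwo r →L[ℂ] LTwo r} {μ : C(Torus r, ℂ)}
    (hμ : ∀ p, ‖μ p‖ = 1) (hX : Commute X (mulHom r μ)) {φ ψ : C(Torus r, ℂ)}
    {A B : Set (Torus r)} (hA : IsClosed A) (hB : IsClosed B) (hφ : Function.support φ ⊆ A)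
    (hψ : Function.support ψ ⊆ B) (hd : ∀ p ∈ A, ∀ q ∈ B, μ p ≠ μ q) :
    mulHom r φ * X * mulHom r ψ = 0 := by
  have hA' : IsClosed (μ '' A) := (hA.isCompact.image μ.continuous).isClosed
  have hB' : IsClosed (μ '' B) := (hB.isCompact.image μ.continuous).isClosed
  have hdisj : Disjoint (μ '' B) (μ '' A) := by
    rw [Set.disjoint_left]
    rintro _ ⟨q, hq, rfl⟩ ⟨p, hp, h⟩
    exact hd p hp q hq h
  -- `u ∘ μ` is `1` on the support of `φ` and `0` on that of `ψ`; it is inserted next to `φ` and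
  -- carried through `X` to annihilate `ψ`.
  obtain ⟨u, hu0, hu1, -⟩ := exists_continuous_zero_one_of_isClosed hB' hA' hdisj
  let u' : C(ℂ, ℂ) := ⟨fun z => (u z : ℂ), Complex.continuous_ofReal.comp u.continuous⟩
  have h1 : φ * u'.comp μ = φ := by
    ext p
    by_cases hp : φ p = 0
    · simp [hp]
    · have h := hu1 ⟨p, hφ hp, rfl⟩
      change φ p * ((u (μ p) : ℝ) : ℂ) = φ p
      rw [h]
      simp
  have h2 : u'.comp μ * ψ = 0 := by
    ext p
    by_cases hp : ψ p = 0
    · simp [hp]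
    · have h := hu0 ⟨p, hψ hp, rfl⟩
      change ((u (μ p) : ℝ) : ℂ) * ψ p = 0
      rw [h]
      simp
  have hc := commute_mulHom_comp hμ hX u'
  calc mulHom r φ * X * mulHom r ψ = mulHom r φ * (mulHom r (u'.comp μ) * X) * mulHom r ψ := by
        nth_rewrite 1 [← h1]
        rw [map_mul, mul_assoc (mulHom r φ)]
    _ = mulHom r φ * X * mulHom r (u'.comp μ * ψ) := by
        rw [← hc.eq, map_mul]
        simp only [mul_assoc]
    _ = 0 := by rw [h2, map_zero, mul_zero]

/-- An operator that commutes with multiplication by a unimodular function `μ` commutes with all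
multiplication operators when it is localized to a set on which `μ` is injective. -/
theorem mulHom_commutator_eq_zero_of_injOn {X : LTwo r →L[ℂ] LTwo r} {μ : C(Torus r, ℂ)}
    (hμ : ∀ p, ‖μ p‖ = 1) (hX : Commute X (mulHom r μ)) {φ ψ : C(Torus r, ℂ)}
    {K : Set (Torus r)} (hK : IsClosed K) (hinj : Set.InjOn μ K)
    (hφ : Function.support φ ⊆ K) (hψ : Function.support ψ ⊆ K) (a : C(Torus r, ℂ)) :
    mulHom r φ * (X * mulHom r a - mulHom r a * X) * mulHom r ψ = 0 := by
  have hKc : CompactSpace K := isCompact_iff_compactSpace.1 hK.isCompact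
  have he : Topology.IsClosedEmbedding (fun p : K => μ p) :=
    (μ.continuous.comp continuous_subtype_val).isClosedEmbedding
      (Set.injOn_iff_injective.1 hinj)
  -- On `K` the map `μ` is an embedding, so by Tietze's theorem `a` agrees there with a continuous
  -- function of `μ`.
  obtain ⟨u, hu⟩ := (a.restrict K).exists_extension' he
  have hu' : ∀ p ∈ K, u (μ p) = a p := fun p hp => congrFun hu ⟨p, hp⟩
  have h1 : ∀ χ : C(Torus r, ℂ), Function.support χ ⊆ K → u.comp μ * χ = a * χ := by
    intro χ hχ
    ext p
    by_cases hp : χ p = 0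
    · simp [hp]
    · change u (μ p) * χ p = a p * χ p
      rw [hu' p (hχ hp)]
  have hc := commute_mulHom_comp hμ hX u
  rw [mul_sub, sub_mul, sub_eq_zero]
  calc mulHom r φ * (X * mulHom r a) * mulHom r ψ = mulHom r φ * X * mulHom r (a * ψ) := by
        rw [map_mul]
        simp only [mul_assoc]
    _ = mulHom r φ * (X * mulHom r (u.comp μ)) * mulHom r ψ := by
        rw [← h1 ψ hψ, map_mul]
        simp only [mul_assoc]
    _ = mulHom r (u.comp μ * φ) * X * mulHom r ψ := by
        rw [hc.eq, mul_comm (u.comp μ) φ, map_mul]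
        simp only [mul_assoc]
    _ = mulHom r φ * (mulHom r a * X) * mulHom r ψ := by
        rw [h1 φ hφ, mul_comm a φ, map_mul]
        simp only [mul_assoc]

end Localization

/-! ### Vanishing between points separated by small translates -/

section Separation

/-- Points in two compact sets with equal values `z` under `μ`, on which `μ` is injective, can be
separated by one member of a family of maps on a whole neighbourhood of `z`. -/
theorem exists_isOpen_separated {T ι : Type*} [TopologicalSpace T] {μ : T → ℂ}
    (hμ : Continuous μ) {ν : ι → T → ℂ} (hν : ∀ k, Continuous (ν k)) {K L : Set T}
    (hK : IsCompact K) (hL : IsCompact L) (hiK : Set.InjOn μ K) (hiL : Set.InjOn μ L)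
    {P : ι → Prop} (hP : ∃ k, P k)
    (hsep : ∀ p ∈ K, ∀ q ∈ L, ∃ k, P k ∧ ν k p ≠ ν k q) (z : ℂ) :
    ∃ V : Set ℂ, IsOpen V ∧ z ∈ V ∧ ∃ k, P k ∧
      ∀ p ∈ K, ∀ q ∈ L, μ p ∈ V → μ q ∈ V → ν k p ≠ ν k q := by
  by_cases hz : z ∈ μ '' K
  · by_cases hz' : z ∈ μ '' L
    · obtain ⟨p, hp, rfl⟩ := hz
      obtain ⟨q, hq, hqp⟩ := hz'
      obtain ⟨k, hk, hne⟩ := hsep p hp q hq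
      obtain ⟨A, B, hA, hB, hpA, hqB, hAB⟩ := t2_separation hne
      have hA' : IsOpen (ν k ⁻¹' A) := hA.preimage (hν k)
      have hB' : IsOpen (ν k ⁻¹' B) := hB.preimage (hν k)
      -- By injectivity `p` and `q` are the only points of `K` and `L` above `z`. Deleting the
      -- compact set of values taken where `ν k` leaves `A` or `B` therefore keeps `z`.
      refine ⟨(μ '' (K \ ν k ⁻¹' A))ᶜ ∩ (μ '' (L \ ν k ⁻¹' B))ᶜ,
        ((hK.diff hA').image hμ).isClosed.isOpen_compl.inter
          ((hL.diff hB').image hμ).isClosed.isOpen_compl, ⟨?_, ?_⟩, k, hk, ?_⟩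
      · rintro ⟨p', hp', h⟩
        rw [hiK hp'.1 hp h] at hp'
        exact hp'.2 hpA
      · rintro ⟨q', hq', h⟩
        rw [hiL hq'.1 hq (h.trans hqp.symm)] at hq'
        exact hq'.2 hqB
      · intro p' hp' q' hq' h1 h2 h3
        have h4 : ν k p' ∈ A := by
          by_contra h
          exact h1.1 ⟨p', ⟨hp', h⟩, rfl⟩
        have h5 : ν k q' ∈ B := by
          by_contra h
          exact h2.2 ⟨q', ⟨hq', h⟩, rfl⟩
        exact Set.disjoint_left.1 hAB h4 (h3 ▸ h5)
    -- Nothing in `L` lies above `z`, so near `z` the separation is vacuous and any admissible `k`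
    -- serves.
    · obtain ⟨k, hk⟩ := hP
      exact ⟨(μ '' L)ᶜ, (hL.image hμ).isClosed.isOpen_compl, hz', k, hk,
        fun p _ q hq _ h => absurd ⟨q, hq, rfl⟩ h⟩
  · obtain ⟨k, hk⟩ := hP
    exact ⟨(μ '' K)ᶜ, (hK.image hμ).isClosed.isOpen_compl, hz, k, hk,
      fun p hp q _ h _ => absurd ⟨p, hp, rfl⟩ h⟩

/-- A finite partition into squares of real functions, subordinate to an open cover of a compact
set. -/
theorem exists_sq_partition {s : Set ℂ} (hs : IsCompact s) {V : ℂ → Set ℂ}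
    (ho : ∀ z, IsOpen (V z)) (hV : ∀ z, z ∈ V z) :
    ∃ (t : Finset ℂ) (g : t → C(ℂ, ℝ)), (∀ i, tsupport (g i) ⊆ V i) ∧
      ∀ z ∈ s, ∑ i, g i z * g i z = 1 := by
  obtain ⟨t, -, ht⟩ := hs.elim_nhds_subcover V fun z _ => (ho z).mem_nhds (hV z)
  obtain ⟨f, hf⟩ := PartitionOfUnity.exists_isSubordinate hs.isClosed (fun i : t => V i)
    (fun i => ho i) (by simpa [Set.iUnion_subtype] using ht)
  refine ⟨t, fun i => ⟨fun z => √(f i z), Real.continuous_sqrt.comp (f i).continuous⟩, ?_, ?_⟩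
  · intro i
    refine (closure_mono ?_).trans (hf i)
    intro z hz hz'
    apply hz
    change √(f i z) = 0
    rw [hz', Real.sqrt_zero]
  · intro z hz
    have h := f.sum_eq_one hz
    rw [finsum_eq_sum_of_fintype] at h
    rw [← h]
    exact Finset.sum_congr rfl fun i _ => Real.mul_self_sqrt (f.nonneg i z)

variable {r : ℝ} [hr : Fact (0 < r)]

theorem inner_mulHom_left (a : C(Torus r, ℂ)) (f g : LTwo r) :
    inner ℂ (mulHom r a f) g = inner ℂ f (mulHom r (star a) g) := by
  rw [map_star, ContinuousLinearMap.star_eq_adjoint, ContinuousLinearMap.adjoint_inner_right]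

/-- An operator that commutes with multiplication by `μ` and that is close to the translates
which separate the supports of `φ` and `ψ` is small between `φ` and `ψ`. -/
theorem norm_inner_mulHom_le {X : LTwo r →L[ℂ] LTwo r} {μ : C(Torus r, ℂ)}
    (hμ : ∀ p, ‖μ p‖ = 1) (hX : Commute X (mulHom r μ)) {φ ψ : C(Torus r, ℂ)}
    {K L : Set (Torus r)} (hK : IsClosed K) (hL : IsClosed L)
    (hφ : Function.support φ ⊆ K) (hψ : Function.support ψ ⊆ L)
    (hiK : Set.InjOn μ K) (hiL : Set.InjOn μ L) {ε : ℝ} (hε : 0 ≤ ε)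
    (hsep : ∀ p ∈ K, ∀ q ∈ L, ∃ k : ℝ, ‖flowConj r X k - X‖ ≤ ε ∧
      μ (p + (k : Torus r)) ≠ μ (q + (k : Torus r))) (f g : LTwo r) :
    ‖inner ℂ (mulHom r (star φ) f) (X (mulHom r ψ g))‖ ≤
      ε * (‖mulHom r (star φ) f‖ * ‖mulHom r ψ g‖) := by
  have hP : ∃ k : ℝ, ‖flowConj r X k - X‖ ≤ ε := ⟨0, by simpa [flowConj_zero] using hε⟩
  -- Above each `V z` a single shift `k z` separates `K` from `L`. A partition subordinate to the `V
  -- z`, composed with `μ`, commutes with `X`, so it may serve as the blocks of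
  -- `norm_inner_le_of_blocks`.
  choose V hVo hV k hk hkV using exists_isOpen_separated μ.continuous
    (fun k : ℝ => (translate r k μ).continuous) hK.isCompact hL.isCompact hiK hiL hP hsep
  obtain ⟨t, u, hu, hsum⟩ := exists_sq_partition (isCompact_sphere (0 : ℂ) 1) hVo hV
  let v : t → C(ℂ, ℂ) := fun i => ⟨fun z => (u i z : ℂ),
    Complex.continuous_ofReal.comp (u i).continuous⟩
  let a : t → C(Torus r, ℂ) := fun i => (v i).comp μ
  have ha : ∀ i, star (a i) = a i := by
    intro i
    ext p
    exact Complex.conj_ofReal _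
  have hcomm : ∀ i, Commute X (mulHom r (a i)) := fun i => commute_mulHom_comp hμ hX (v i)
  refine norm_inner_le_of_blocks (A := fun i => mulHom r (a i)) (fun i => ?_) ?_ hcomm hε _ _ ?_
  · change star (mulHom r (a i)) = mulHom r (a i)
    rw [← map_star, ha]
  · have h : ∑ i, a i * a i = 1 := by
      ext p
      rw [ContinuousMap.sum_apply]
      have h1 := hsum (μ p) (by simpa using hμ p)
      have h2 : ((∑ i, u i (μ p) * u i (μ p) : ℝ) : ℂ) = 1 := by rw [h1, Complex.ofReal_one]
      push_cast at h2
      exact h2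
    rw [← map_one (mulHom r), ← h, map_sum]
    exact Finset.sum_congr rfl fun i _ => (map_mul _ _ _).symm
  · intro i
    have hcl : IsClosed (μ ⁻¹' tsupport (u i)) := (isClosed_tsupport _).preimage μ.continuous
    -- The conjugate commutes with the translate of `μ` that separates the two supports in this
    -- block, so its block vanishes. The block of `X` is then bounded by the distance from `X` to
    -- the conjugate.
    have hz : mulHom r (φ * a i) * flowConj r X (k i) * mulHom r (a i * ψ) = 0 := by
      refine mulHom_mul_mul_eq_zero_of_disjoint_image (μ := translate r (k i) μ)
        (fun p => hμ _) (commute_flowConj r hX (k i)) (hK.inter hcl) (hL.inter hcl) ?_ ?_ ?_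
      · intro p hp
        have hp' : φ p * ((u i (μ p) : ℝ) : ℂ) ≠ 0 := hp
        refine ⟨hφ (left_ne_zero_of_mul hp'), subset_tsupport _ ?_⟩
        exact fun h => right_ne_zero_of_mul hp' (by rw [h, Complex.ofReal_zero])
      · intro p hp
        have hp' : ((u i (μ p) : ℝ) : ℂ) * ψ p ≠ 0 := hp
        refine ⟨hψ (right_ne_zero_of_mul hp'), subset_tsupport _ ?_⟩
        exact fun h => left_ne_zero_of_mul hp' (by rw [h, Complex.ofReal_zero])
      · intro p hp q hq
        exact hkV i p hp.1 q hq.1 (hu i hp.2) (hu i hq.2)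
    have hF : mulHom r (a i) (mulHom r (star φ) f) = mulHom r (star (φ * a i)) f := by
      rw [star_mul, ha, map_mul]
      rfl
    have hG : mulHom r (a i) (mulHom r ψ g) = mulHom r (a i * ψ) g := by
      rw [map_mul]
      rfl
    have hin : inner ℂ (mulHom r (star (φ * a i)) f)
        (flowConj r X (k i) (mulHom r (a i * ψ) g)) = 0 := by
      rw [inner_mulHom_left, star_star]
      have h := congrArg (fun T : LTwo r →L[ℂ] LTwo r => T g) hz
      have h' : mulHom r (φ * a i) (flowConj r X (k i) (mulHom r (a i * ψ) g)) = 0 := h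
      rw [h', inner_zero_right]
    change ‖inner ℂ (mulHom r (a i) (mulHom r (star φ) f))
      (X (mulHom r (a i) (mulHom r ψ g)))‖ ≤ ε * (‖mulHom r (a i) (mulHom r (star φ) f)‖ *
        ‖mulHom r (a i) (mulHom r ψ g)‖)
    rw [hF, hG]
    set F := mulHom r (star (φ * a i)) f
    set G := mulHom r (a i * ψ) g
    have h1 : inner ℂ F (X G) = - inner ℂ F ((flowConj r X (k i) - X) G) := by
      rw [sub_apply, inner_sub_right, hin, zero_sub, neg_neg]
    rw [h1, norm_neg]
    calc ‖inner ℂ F ((flowConj r X (k i) - X) G)‖ ≤ ‖F‖ * ‖(flowConj r X (k i) - X) G‖ :=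
          norm_inner_le_norm _ _
      _ ≤ ‖F‖ * (ε * ‖G‖) := by
          gcongr
          exact (ContinuousLinearMap.le_opNorm _ _).trans (by gcongr; exact hk i)
      _ = ε * (‖F‖ * ‖G‖) := by ring

/-- The partition behind `norm_inner_mulHom_le` changes with `ε`, but its bound does not see the
number of pieces, so `ε` can tend to `0`. -/
theorem mulHom_mul_mul_eq_zero {X : LTwo r →L[ℂ] LTwo r} {μ : C(Torus r, ℂ)}
    (hμ : ∀ p, ‖μ p‖ = 1) (hX : Commute X (mulHom r μ)) {φ ψ : C(Torus r, ℂ)}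
    {K L : Set (Torus r)} (hK : IsClosed K) (hL : IsClosed L)
    (hφ : Function.support φ ⊆ K) (hψ : Function.support ψ ⊆ L)
    (hiK : Set.InjOn μ K) (hiL : Set.InjOn μ L)
    (hsep : ∀ ε : ℝ, 0 < ε → ∀ p ∈ K, ∀ q ∈ L, ∃ k : ℝ, ‖flowConj r X k - X‖ ≤ ε ∧
      μ (p + (k : Torus r)) ≠ μ (q + (k : Torus r))) :
    mulHom r φ * X * mulHom r ψ = 0 := by
  have h : ∀ f g : LTwo r, inner ℂ (mulHom r (star φ) f) (X (mulHom r ψ g)) = 0 := by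
    intro f g
    rw [← norm_le_zero_iff]
    refine le_of_forall_pos_le_add fun δ hδ => ?_
    set C := ‖mulHom r (star φ) f‖ * ‖mulHom r ψ g‖
    have hC : 0 ≤ C := by positivity
    -- The summand `1` keeps the denominator positive when `C = 0`.
    have h1 := norm_inner_mulHom_le hμ hX hK hL hφ hψ hiK hiL (ε := δ / (C + 1))
      (by positivity) (hsep _ (by positivity)) f g
    refine h1.trans ?_
    rw [zero_add, div_mul_eq_mul_div, div_le_iff₀ (by positivity)]
    nlinarith
  ext1 g
  refine ext_inner_left ℂ fun f => ?_
  have h1 := h f g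
  rw [inner_mulHom_left, star_star] at h1
  rw [zero_apply, inner_zero_right]
  exact h1

end Separation

/-! ### From separation of points to commutation with all functions -/

section Commutation

open Topology

variable {r : ℝ} [hr : Fact (0 < r)]

/-- An element of `L²` vanishes if it vanishes locally around almost every point. -/
theorem eq_zero_of_locally_eq_zero {h : LTwo r}
    (hl : ∀ᵐ p ∂(haarAddCircle (T := 2 * Real.pi * r⁻¹)), ∃ N ∈ 𝓝 p, ∀ φ : C(Torus r, ℂ),
      Function.support φ ⊆ N → mulHom r φ h = 0) : h = 0 := by
  have hnull : haarAddCircle (T := 2 * Real.pi * r⁻¹) ({p | h p ≠ 0} ∩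
      {p | ∃ N ∈ 𝓝 p, ∀ φ : C(Torus r, ℂ), Function.support φ ⊆ N → mulHom r φ h = 0}) = 0 := by
    refine measure_null_of_locally_null _ ?_
    rintro p ⟨-, N, hN, hφN⟩
    have hp : Disjoint (interior N)ᶜ {p} := by
      rw [Set.disjoint_singleton_right]
      exact fun h => h (mem_interior_iff_mem_nhds.2 hN)
    obtain ⟨f, hf0, hf1, -⟩ := exists_continuous_zero_one_of_isClosed
      isOpen_interior.isClosed_compl isClosed_singleton hp
    let φ : C(Torus r, ℂ) := ⟨fun p => (f p : ℂ), Complex.continuous_ofReal.comp f.continuous⟩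
    have hsupp : Function.support φ ⊆ N := by
      intro x hx
      by_contra hxN
      apply hx
      change ((f x : ℝ) : ℂ) = 0
      rw [hf0 fun h => hxN (interior_subset h), Pi.zero_apply, Complex.ofReal_zero]
    have hz := hφN φ hsupp
    have hfp : f p ≠ 0 := by
      rw [hf1 rfl]
      exact one_ne_zero
    refine ⟨{x | f x ≠ 0} ∩ {x | h x ≠ 0}, ?_, ?_⟩
    · refine Filter.inter_mem (mem_nhdsWithin_of_mem_nhds
        (f.continuous.continuousAt.eventually_ne hfp)) ?_
      exact Filter.mem_of_superset self_mem_nhdsWithin fun x hx => hx.1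
    · have h1 := mulOp_ae r φ h
      have h2 : mulOp r φ h = 0 := hz
      rw [h2] at h1
      have h3 : ∀ᵐ x ∂(haarAddCircle (T := 2 * Real.pi * r⁻¹)),
          ¬ (x ∈ {x | f x ≠ 0} ∩ {x | h x ≠ 0}) := by
        filter_upwards [h1, Lp.coeFn_zero ℂ 2 (haarAddCircle (T := 2 * Real.pi * r⁻¹))]
          with x hx hx0
        rintro ⟨hx1, hx2⟩
        rw [hx0] at hx
        exact mul_ne_zero (Complex.ofReal_ne_zero.2 hx1) hx2 hx.symm
      exact measure_eq_zero_iff_ae_notMem.2 h3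
  apply Lp.ext
  filter_upwards [hl, measure_eq_zero_iff_ae_notMem.1 hnull,
    Lp.coeFn_zero ℂ 2 (haarAddCircle (T := 2 * Real.pi * r⁻¹))] with p h1 h2 h3
  rw [h3]
  by_contra h4
  exact h2 ⟨h4, h1⟩

/-- The commutator is localized on both sides: near the diagonal `a` is a function of `μ`, and away
from it `X` itself vanishes. Local injectivity is known only almost everywhere, so the two sides are
treated one after the other, each by `eq_zero_of_locally_eq_zero`. -/
theorem commute_mulHom_of_separation {X : LTwo r →L[ℂ] LTwo r} {μ : C(Torus r, ℂ)}
    (hμ : ∀ p, ‖μ p‖ = 1) (hX : Commute X (mulHom r μ))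
    (hloc : ∀ᵐ p ∂(haarAddCircle (T := 2 * Real.pi * r⁻¹)), ∃ N ∈ 𝓝 p, Set.InjOn μ N)
    (hsep : ∀ ε : ℝ, 0 < ε → ∀ p q : Torus r, p ≠ q → ∃ k : ℝ, ‖flowConj r X k - X‖ ≤ ε ∧
      μ (p + (k : Torus r)) ≠ μ (q + (k : Torus r))) (a : C(Torus r, ℂ)) :
    Commute X (mulHom r a) := by
  set E := X * mulHom r a - mulHom r a * X with hE
  have hfirst : ∀ q : Torus r, (∃ N ∈ 𝓝 q, Set.InjOn μ N) → ∃ L ∈ 𝓝 q, ∀ ψ : C(Torus r, ℂ),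
      Function.support ψ ⊆ L → E * mulHom r ψ = 0 := by
    rintro q ⟨N, hN, hinj⟩
    obtain ⟨K, hK, hKc, hKN⟩ := exists_mem_nhds_isClosed_subset hN
    -- With `L` inside the interior of `K`, every `p` is either interior to `K` or has a
    -- neighbourhood disjoint from `L`.
    obtain ⟨L, hL, hLc, hLK⟩ := exists_mem_nhds_isClosed_subset (interior_mem_nhds.2 hK)
    refine ⟨L, hL, fun ψ hψ => ?_⟩
    have hLK' : L ⊆ K := hLK.trans interior_subset
    ext1 g
    refine eq_zero_of_locally_eq_zero ?_
    filter_upwards [hloc] with p hp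
    by_cases hpK : p ∈ interior K
    · refine ⟨K, mem_interior_iff_mem_nhds.1 hpK, fun φ hφ => ?_⟩
      exact congrArg (fun T : LTwo r →L[ℂ] LTwo r => T g)
        (mulHom_commutator_eq_zero_of_injOn hμ hX hKc (hinj.mono hKN) hφ (hψ.trans hLK') a)
    · obtain ⟨N', hN', hinj'⟩ := hp
      obtain ⟨K', hK', hKc', hKN'⟩ := exists_mem_nhds_isClosed_subset
        (Filter.inter_mem hN' (hLc.isOpen_compl.mem_nhds fun h => hpK (hLK h)))
      have hzero : ∀ φ χ : C(Torus r, ℂ), Function.support φ ⊆ K' → Function.support χ ⊆ L →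
          mulHom r φ * X * mulHom r χ = 0 := by
        intro φ χ hφ hχ
        refine mulHom_mul_mul_eq_zero hμ hX hKc' hLc hφ hχ
          (hinj'.mono fun x hx => (hKN' hx).1) (hinj.mono (hLK'.trans hKN)) ?_
        intro ε hε x hx y hy
        refine hsep ε hε x y ?_
        rintro rfl
        exact (hKN' hx).2 hy
      refine ⟨K', hK', fun φ hφ => ?_⟩
      have h1 := hzero φ (a * ψ) hφ ((Function.support_mul_subset_right _ _).trans hψ)
      have h2 := hzero (φ * a) ψ ((Function.support_mul_subset_left _ _).trans hφ) hψ
      have h3 : mulHom r φ * E * mulHom r ψ = 0 := by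
        rw [hE, mul_sub, sub_mul, sub_eq_zero]
        rw [map_mul] at h1 h2
        simp only [mul_assoc] at h1 h2 ⊢
        rw [h1, h2]
      exact congrArg (fun T : LTwo r →L[ℂ] LTwo r => T g) h3
  -- `hfirst` localizes `E` on the right; the adjoint turns this into multiplication on the left,
  -- where the local criterion applies again.
  have hstar : star E = 0 := by
    ext1 f
    refine eq_zero_of_locally_eq_zero ?_
    filter_upwards [hloc] with q hq
    obtain ⟨L, hL, hψ⟩ := hfirst q hq
    refine ⟨L, hL, fun φ hφ => ?_⟩
    have h1 := hψ (star φ) fun x hx => hφ fun h => hx (by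
      change star (φ x) = 0
      rw [h, star_zero])
    have h2 := congrArg star h1
    rw [star_mul, star_zero, ← map_star, star_star] at h2
    exact congrArg (fun T : LTwo r →L[ℂ] LTwo r => T f) h2
  rw [star_eq_zero, hE, sub_eq_zero] at hstar
  exact hstar

end Commutation

/-! ### Separation and local injectivity for prime analytic maps -/

section AnalyticMaps

open Topology

variable {r : ℝ}

theorem IsAnalyticMap.analyticOnNhd_add {lam : Torus r → Circle} (h : IsAnalyticMap lam)
    (p : Torus r) : AnalyticOnNhd ℝ (fun k : ℝ => (lam (p + (k : Torus r)) : ℂ)) Set.univ := by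
  induction p using QuotientAddGroup.induction_on with
  | H p =>
    have h1 : AnalyticOnNhd ℝ (fun k : ℝ => p + k) Set.univ :=
      analyticOnNhd_const.add analyticOnNhd_id
    exact AnalyticOnNhd.comp (t := Set.univ) (g := fun k : ℝ => (lam (k : Torus r) : ℂ)) h h1
      (Set.mapsTo_univ _ _)

/-- Two different points are separated by arbitrarily small translates of an analytic map without
periods. -/
theorem IsPrimeMap.exists_small_separation {lam : Torus r → Circle} (h : IsAnalyticMap lam)
    (hp : IsPrimeMap lam) {p q : Torus r} (hpq : p ≠ q) {P : ℝ → Prop} (hP : ∀ᶠ k in 𝓝 0, P k) :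
    ∃ k : ℝ, P k ∧ (lam (p + (k : Torus r)) : ℂ) ≠ lam (q + (k : Torus r)) := by
  by_contra! hc
  have he := (h.analyticOnNhd_add p).eq_of_eventuallyEq (h.analyticOnNhd_add q) (hP.mono hc)
  apply hpq
  refine (sub_eq_zero.1 (hp (q - p) fun k => ?_)).symm
  obtain ⟨x, hx⟩ := QuotientAddGroup.mk_surjective (k - p)
  have h1 := congrFun he x
  have hx' : ((x : ℝ) : Torus r) = k - p := hx
  simp only [hx', add_sub_cancel] at h1
  have h2 : k + (q - p) = q + (k - p) := by abel
  rw [h2]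
  exact Circle.ext h1.symm

theorem nullSingletonClass_haarAddCircle (T : ℝ) [hT : Fact (0 < T)] :
    NullSingletonClass (haarAddCircle (T := T)) where
  measure_singleton x := by
    have h := AddCircle.volume_closedBall (T := T) (x := x) 0
    rw [Metric.closedBall_zero, mul_zero, min_eq_right hT.out.le, ENNReal.ofReal_zero,
      volume_eq_smul_haarAddCircle, Measure.smul_apply, smul_eq_mul, mul_eq_zero] at h
    exact h.resolve_left (by simpa using hT.out)

variable [hr : Fact (0 < r)]

/-- This rules out constant maps, for which every `τ` is a period. The witness is half of the
circumference. -/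
theorem exists_torus_ne_zero : ∃ τ : Torus r, τ ≠ 0 := by
  have hT : 0 < 2 * Real.pi * r⁻¹ := (torusLengthPos r).out
  refine ⟨((2 * Real.pi * r⁻¹ / 2 : ℝ) : Torus r), fun h => ?_⟩
  obtain ⟨n, hn⟩ := (AddCircle.coe_eq_zero_iff _).1 h
  rw [zsmul_eq_mul] at hn
  have h1 : ((2 * n : ℤ) : ℝ) = ((1 : ℤ) : ℝ) := by
    push_cast
    have h2 : (2 * (n : ℝ)) * (2 * Real.pi * r⁻¹) = 1 * (2 * Real.pi * r⁻¹) := by linarith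
    exact mul_right_cancel₀ hT.ne' h2
  have h2 : 2 * n = 1 := by exact_mod_cast h1
  omega

/-- The real derivative `ℝ → ℂ` is not surjective, so the inverse function theorem is replaced by
strict differentiability: near `x`, `f y - f z` differs from `(y - z) • deriv f x` by at most half
the norm of the latter. -/
theorem injOn_nhds_of_deriv_ne_zero {f : ℝ → ℂ} {x : ℝ} (hf : AnalyticAt ℝ f x)
    (hd : deriv f x ≠ 0) : ∃ N ∈ 𝓝 x, Set.InjOn f N := by
  have hs := hf.hasStrictDerivAt.hasStrictFDerivAt
  have h1 := hs.isLittleO.def (half_pos (norm_pos_iff.2 hd))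
  obtain ⟨N, hN, N', hN', hNN⟩ := mem_nhds_prod_iff.1 h1
  refine ⟨N ∩ N', Filter.inter_mem hN hN', fun y hy z hz hyz => ?_⟩
  have h2 : ‖f y - f z - (y - z) • deriv f x‖ ≤ ‖deriv f x‖ / 2 * ‖y - z‖ :=
    hNN (show (y, z) ∈ N ×ˢ N' from ⟨hy.1, hz.2⟩)
  rw [hyz, sub_self, zero_sub, norm_neg, norm_smul] at h2
  have h3 := norm_pos_iff.2 hd
  have h4 : ‖y - z‖ = 0 := by nlinarith [norm_nonneg (y - z)]
  exact sub_eq_zero.1 (norm_eq_zero.1 h4)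

/-- The derivative is analytic. If it vanished identically, `lam` would be constant and not prime;
otherwise its zeros are discrete, hence countable, and their image is null. -/
theorem IsPrimeMap.ae_injOn_nhds {lam : Torus r → Circle} (h : IsAnalyticMap lam)
    (hp : IsPrimeMap lam) : ∀ᵐ p ∂(haarAddCircle (T := 2 * Real.pi * r⁻¹)),
      ∃ N ∈ 𝓝 p, Set.InjOn h.toContinuousMap N := by
  set f : ℝ → ℂ := fun k => (lam (k : Torus r) : ℂ) with hf
  have hcount : {x : ℝ | deriv f x = 0}.Countable := by
    rcases (AnalyticOnNhd.deriv h).eqOn_zero_or_eventually_ne_zero_of_preconnected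
      isPreconnected_univ with h0 | h0
    · exfalso
      obtain ⟨τ, hτ⟩ := exists_torus_ne_zero (r := r)
      have hconst := is_const_of_deriv_eq_zero
        (fun x => (h x (Set.mem_univ x)).differentiableAt) fun x => h0 (Set.mem_univ x)
      refine hτ (hp τ fun k => ?_)
      obtain ⟨x, hx⟩ := QuotientAddGroup.mk_surjective k
      obtain ⟨y, hy⟩ := QuotientAddGroup.mk_surjective (k + τ)
      rw [← hx, ← hy] at *
      exact Circle.ext (hconst y x)
    · have h1 : {x : ℝ | deriv f x = 0}ᶜ ∈ Filter.codiscreteWithin Set.univ := h0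
      have h2 := isDiscrete_of_codiscreteWithin h1
      rw [Set.inter_univ] at h2
      have h3 := isDiscrete_iff_discreteTopology.1 h2
      exact TopologicalSpace.separableSpace_iff_countable.1 inferInstance
  have := nullSingletonClass_haarAddCircle (2 * Real.pi * r⁻¹)
  have hnull := (hcount.image (fun x : ℝ => (x : Torus r))).measure_zero
    (haarAddCircle (T := 2 * Real.pi * r⁻¹))
  filter_upwards [measure_eq_zero_iff_ae_notMem.1 hnull] with p hpz
  obtain ⟨x, rfl⟩ := QuotientAddGroup.mk_surjective p
  have hd : deriv f x ≠ 0 := fun hd => hpz ⟨x, hd, rfl⟩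
  obtain ⟨N, hN, hinj⟩ := injOn_nhds_of_deriv_ne_zero (h x (Set.mem_univ x)) hd
  refine ⟨(fun x : ℝ => (x : Torus r)) '' N,
    QuotientAddGroup.isOpenMap_coe.image_mem_nhds hN, ?_⟩
  rintro _ ⟨y, hy, rfl⟩ _ ⟨z, hz, rfl⟩ hyz
  exact congrArg _ (hinj hy hz hyz)

/-- An operator that commutes with multiplication by a prime analytic map and whose translates
depend continuously on the translation commutes with all multiplication operators. -/
theorem IsPrimeMap.commute_mulHom {lam : Torus r → Circle} (h : IsAnalyticMap lam)
    (hp : IsPrimeMap lam) {X : LTwo r →L[ℂ] LTwo r} (hX : Commute X (mulHom r h.toContinuousMap))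
    (hc : Continuous (flowConj r X)) (a : C(Torus r, ℂ)) : Commute X (mulHom r a) := by
  refine commute_mulHom_of_separation (fun p => Circle.norm_coe _) hX (hp.ae_injOn_nhds h) ?_ a
  intro ε hε p q hpq
  refine hp.exists_small_separation h hpq ?_
  have h1 : Filter.Tendsto (fun k => ‖flowConj r X k - X‖) (𝓝 0) (𝓝 0) := by
    have h2 := ((hc.sub continuous_const).norm (E := LTwo r →L[ℂ] LTwo r)).tendsto
      (f := fun k => ‖flowConj r X k - X‖) 0
    simpa [flowConj_zero] using h2
  exact h1.eventually_le_const hε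

end AnalyticMaps

/-! ### Averages over the flow and continuity of the symbol -/

section Averages

open Topology

variable (r : ℝ) [hr : Fact (0 < r)]

/-- The average of the phases `exp (i k x)` over `k` between `0` and `δ`. -/
def phaseAverage (δ x : ℝ) : ℂ := (δ : ℂ)⁻¹ * ∫ k in (0 : ℝ)..δ, phase k x

/-- The primitive `(i x)⁻¹ exp (i k x)` supplies the factor `|x|⁻¹`, and its two endpoint phases the
factor `2`. -/
theorem norm_phaseAverage_le {δ x : ℝ} (hx : x ≠ 0) : ‖phaseAverage δ x‖ ≤ 2 * |δ|⁻¹ * |x|⁻¹ := by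
  have hc : Complex.I * (x : ℂ) ≠ 0 := mul_ne_zero Complex.I_ne_zero (by exact_mod_cast hx)
  have h1 : ∀ k : ℝ, HasDerivAt (fun k : ℝ => (Complex.I * (x : ℂ))⁻¹ * phase k x) (phase k x) k := by
    intro k
    have h2 := (hasDerivAt_phase k x).const_mul (Complex.I * (x : ℂ))⁻¹
    rwa [inv_mul_cancel_left₀ hc] at h2
  rw [phaseAverage, intervalIntegral.integral_eq_sub_of_hasDerivAt (fun k _ => h1 k)
    ((continuous_phase x).intervalIntegrable _ _), ← mul_sub, norm_mul, norm_mul, norm_inv,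
    norm_inv, norm_mul, Complex.norm_I, one_mul, Complex.norm_real, Complex.norm_real,
    Real.norm_eq_abs, Real.norm_eq_abs]
  have h3 : ‖phase δ x - phase 0 x‖ ≤ 2 := by
    refine (norm_sub_le _ _).trans ?_
    rw [norm_phase, norm_phase]
    norm_num
  calc |δ|⁻¹ * (|x|⁻¹ * ‖phase δ x - phase 0 x‖) ≤ |δ|⁻¹ * (|x|⁻¹ * 2) := by gcongr
    _ = 2 * |δ|⁻¹ * |x|⁻¹ := by ring

theorem summable_phaseAverage_sq (δ : ℝ) :
    Summable fun x : Lattice r => ‖phaseAverage δ x‖ ^ 2 := by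
  rw [← (latticeEquiv r).summable_iff]
  have hs : Summable fun n : ℤ => (2 * |δ|⁻¹ * r⁻¹) ^ 2 * (1 / (n : ℝ) ^ 2) :=
    (Real.summable_one_div_int_pow.2 (by norm_num)).mul_left _
  -- The bound fails only at the index `0`, where the dominating term is `0` by the convention for
  -- division.
  refine Summable.of_norm_bounded_eventually hs ?_
  refine Filter.eventually_cofinite.2 ((Set.finite_singleton (0 : ℤ)).subset fun n hn => ?_)
  by_contra hn0
  apply hn
  have hr0 : r ≠ 0 := hr.out.ne'
  have hx : ((latticeEquiv r n : Lattice r) : ℝ) = n * r := zsmul_eq_mul _ _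
  have hx0 : ((latticeEquiv r n : Lattice r) : ℝ) ≠ 0 := by
    rw [hx]
    exact mul_ne_zero (by exact_mod_cast hn0) hr0
  have h := norm_phaseAverage_le (δ := δ) hx0
  rw [Function.comp_apply, norm_pow, norm_norm]
  refine (pow_le_pow_left₀ (norm_nonneg _) h 2).trans_eq ?_
  rw [hx, abs_mul, abs_of_pos hr.out, mul_inv, mul_pow, mul_pow, mul_pow, mul_pow, inv_pow |(n : ℝ)|,
    sq_abs]
  ring

theorem summable_phaseAverage_mul (δ : ℝ) (ξ : EllTwo r) :
    Summable fun x : Lattice r => ‖phaseAverage δ x * ξ x‖ := by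
  have h := (lp.memℓp ξ).summable (by simp)
  simp only [ENNReal.toReal_ofNat, Real.rpow_ofNat] at h
  refine Summable.of_nonneg_of_le (fun _ => norm_nonneg _) (fun x => ?_)
    ((summable_phaseAverage_sq r δ).add h)
  rw [norm_mul]
  nlinarith [sq_nonneg (‖phaseAverage δ x‖ - ‖ξ x‖), norm_nonneg (phaseAverage δ x),
    norm_nonneg (ξ x), sq_nonneg (‖phaseAverage δ x‖ + ‖ξ x‖)]

/-- The `x`-th Fourier coefficient. -/
def fourierCoeffL (x : Lattice r) : LTwo r →L[ℂ] ℂ :=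
  lp.evalCLM ℂ (fun _ : Lattice r => ℂ) 2 x ∘L
    ((fourierTransform r).toContinuousLinearEquiv : LTwo r →L[ℂ] EllTwo r)

theorem fourierCoeffL_apply (x : Lattice r) (f : LTwo r) :
    fourierCoeffL r x f = fourierTransform r f x := rfl

/-- An absolutely summable sequence is the Fourier transform of a continuous function. -/
theorem exists_fourierTransform_eq {ξ : Lattice r → ℂ} (hξ : Summable fun x => ‖ξ x‖) :
    ∃ ρ : C(Torus r, ℂ), ∀ x, fourierTransform r (contToLTwo r ρ) x = ξ x := by
  have hs : Summable fun x => ξ x • character r x := by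
    refine Summable.of_norm (hξ.congr fun x => ?_)
    rw [norm_smul, character, fourier_norm, mul_one]
  refine ⟨∑' x, ξ x • character r x, fun x => ?_⟩
  have h := (fourierCoeffL r x ∘L contToLTwo r).map_tsum hs
  rw [ContinuousLinearMap.comp_apply, fourierCoeffL_apply] at h
  rw [h, tsum_eq_single x]
  · rw [map_smul, ContinuousLinearMap.comp_apply, fourierCoeffL_apply, fourierTransform_character]
    simp
  · intro y hy
    rw [map_smul, ContinuousLinearMap.comp_apply, fourierCoeffL_apply, fourierTransform_character]
    simp [hy.symm]

theorem commute_flowConj_mulHom {X : LTwo r →L[ℂ] LTwo r} (hX : ∀ a, Commute X (mulHom r a))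
    (k : ℝ) (a : C(Torus r, ℂ)) : Commute (flowConj r X k) (mulHom r a) := by
  have h := commute_flowConj r (hX (translate r (-k) a)) k
  have e : translate r k (translate r (-k) a) = a := by
    ext p
    rw [translate_apply, translate_apply, add_assoc, ← AddCircle.coe_add, add_neg_cancel,
      AddCircle.coe_zero, add_zero]
  rwa [e] at h

/-- The averages of the translates of an operator that commutes with all multiplication operators
are multiplication operators with continuous functions. -/
theorem average_flowConj_mem_range {X : LTwo r →L[ℂ] LTwo r} (hX : ∀ a, Commute X (mulHom r a))
    (hc : Continuous (flowConj r X)) (δ : ℝ) :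
    (δ : ℂ)⁻¹ • ∫ k in (0 : ℝ)..δ, flowConj r X k ∈ Set.range (mulHom r) := by
  set Y := (δ : ℂ)⁻¹ • ∫ k in (0 : ℝ)..δ, flowConj r X k with hY
  have hint := hc.intervalIntegrable (μ := volume) 0 δ
  have hcomm : ∀ a, Commute Y (mulHom r a) := by
    intro a
    refine Commute.smul_left ?_ _
    -- The commutator with `mulHom r a` is a bounded linear map, so it passes under the integral.
    let l : (LTwo r →L[ℂ] LTwo r) →L[ℂ] (LTwo r →L[ℂ] LTwo r) :=
      (ContinuousLinearMap.mul ℂ _).flip (mulHom r a) - ContinuousLinearMap.mul ℂ _ (mulHom r a)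
    have hl : ∀ Z, l Z = Z * mulHom r a - mulHom r a * Z := fun Z => rfl
    have h := ContinuousLinearMap.intervalIntegral_comp_comm l hint
    have h0 : ∀ k, l (flowConj r X k) = 0 := by
      intro k
      rw [hl, (commute_flowConj_mulHom r hX k a).eq, sub_self]
    simp only [h0, intervalIntegral.integral_zero] at h
    rw [hl] at h
    exact sub_eq_zero.1 h.symm
  obtain ⟨ρ, hρ⟩ := exists_fourierTransform_eq r
    (summable_phaseAverage_mul r δ (fourierTransform r (X (contToLTwo r 1))))
  refine ⟨ρ, (eq_mulHom_of_commute r hcomm ?_).symm⟩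
  apply (fourierTransform r).injective
  ext x
  rw [hρ]
  let l : (LTwo r →L[ℂ] LTwo r) →L[ℂ] ℂ :=
    fourierCoeffL r x ∘L ContinuousLinearMap.apply ℂ (LTwo r) (contToLTwo r 1)
  have hl : ∀ Z, l Z = fourierTransform r (Z (contToLTwo r 1)) x := fun Z => rfl
  have h := ContinuousLinearMap.intervalIntegral_comp_comm l hint
  -- The flow fixes the constant `1`, so only the outer factor acts, and it multiplies the
  -- coefficient of `X 1` by a phase.
  have h1 : ∀ k, l (flowConj r X k) =
      phase k x * fourierTransform r (X (contToLTwo r 1)) x := by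
    intro k
    rw [hl, flowConj_apply, flow_contToLTwo, translate_one, fourierTransform_flow,
      phaseUnitary_apply]
  rw [← hl, hY, map_smul, ← h]
  simp only [h1]
  rw [intervalIntegral.integral_mul_const, smul_eq_mul, phaseAverage]
  exact (mul_assoc _ _ _).symm

/-- The averages are the difference quotients at `0` of a primitive of `flowConj r X`, so they
converge in norm to `flowConj r X 0 = X`. -/
theorem mem_range_mulHom_of_commute {X : LTwo r →L[ℂ] LTwo r} (hX : ∀ a, Commute X (mulHom r a))
    (hc : Continuous (flowConj r X)) : X ∈ Set.range (mulHom r) := by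
  have h1 := intervalIntegral.integral_hasDerivAt_right (hc.intervalIntegrable (μ := volume) 0 0)
    hc.stronglyMeasurable.stronglyMeasurableAtFilter hc.continuousAt
  rw [hasDerivAt_iff_tendsto_slope, flowConj_zero] at h1
  refine (isClosed_range_mulHom r).mem_of_tendsto h1 (Filter.Eventually.of_forall fun δ => ?_)
  have h2 := average_flowConj_mem_range r hX hc δ
  rw [slope_def_module, intervalIntegral.integral_same, sub_zero, sub_zero]
  convert h2 using 1
  rw [← Complex.ofReal_inv]
  rfl

end Averages

/-! ### The uniform commutant of the model walk -/

section UniformCommutant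

variable {r : ℝ} [hr : Fact (0 < r)] {lam : Torus r → Circle}

theorem modelWalk_U_apply (h : IsAnalyticMap lam) (ξ : EllTwo r) :
    (modelWalk h).U ξ = fourierConj h.toContinuousMap ξ := rfl

theorem commute_fourierPull (h : IsAnalyticMap lam) {X : EllTwo r →L[ℂ] EllTwo r}
    (hX : IsIntertwiner (modelWalk h) (modelWalk h) X) :
    Commute (fourierPull r X) (mulHom r h.toContinuousMap) := by
  ext1 f
  change fourierPull r X (mulHom r h.toContinuousMap f) =
    mulHom r h.toContinuousMap (fourierPull r X f)
  have h1 := hX (fourierTransform r f)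
  rw [modelWalk_U_apply, modelWalk_U_apply, fourierConj_apply, fourierConj_apply,
    LinearIsometryEquiv.symm_apply_apply] at h1
  rw [fourierPull_apply, fourierPull_apply, h1, LinearIsometryEquiv.symm_apply_apply]

theorem uniformCommutant_modelWalk (h : IsAnalyticMap lam) (hp : IsPrimeMap lam) :
    (modelWalk h).uniformCommutant = {X | ∃ ρ : C(Torus r, ℂ), X = fourierConj ρ} := by
  ext X
  constructor
  · rintro ⟨hX, hu⟩
    have hc := IsUniformOp.continuous_flowConj r hu
    obtain ⟨ρ, hρ⟩ := mem_range_mulHom_of_commute r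
      (hp.commute_mulHom h (commute_fourierPull h hX) hc) hc
    exact ⟨ρ, (fourierPull_eq_mulHom_iff r X ρ).1 hρ.symm⟩
  · rintro ⟨ρ, rfl⟩
    refine ⟨fun ξ => ?_, isUniformOp_fourierConj r ρ⟩
    rw [modelWalk_U_apply, modelWalk_U_apply, fourierConj_apply, fourierConj_apply,
      fourierConj_apply, fourierConj_apply, LinearIsometryEquiv.symm_apply_apply,
      LinearIsometryEquiv.symm_apply_apply]
    congr 1
    change (mulHom r ρ * mulHom r h.toContinuousMap) _ =
      (mulHom r h.toContinuousMap * mulHom r ρ) _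
    rw [← map_mul, ← map_mul, mul_comm ρ]

end UniformCommutant

/-! ### Symmetries of the unitary group of a self-adjoint operator -/

section Generators

variable {H : Type*} [NormedAddCommGroup H] [InnerProductSpace ℂ H]

theorem IsUnitaryGroupOf.symm_eq {D : H →ₗ.[ℂ] H} {W : ℝ → (H ≃ₗᵢ[ℂ] H)}
    (hW : IsUnitaryGroupOf D W) (k : ℝ) : (W k).symm = W (-k) := by
  ext ξ
  rw [LinearIsometryEquiv.symm_apply_eq]
  change ξ = (W k * W (-k)) ξ
  rw [← hW.add, add_neg_cancel, hW.zero]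
  rfl

/-- The identity also holds for the default value `1` of `expI`, so Stone's theorem is not needed.
-/
theorem expI_neg_expI (D : H →ₗ.[ℂ] H) (k : ℝ) (ξ : H) : expI D (-k) (expI D k ξ) = ξ := by
  by_cases h : ∃ W : ℝ → (H ≃ₗᵢ[ℂ] H), IsUnitaryGroupOf D W
  · rw [expI, expI, dif_pos h, dif_pos h]
    change h.choose (-k) (h.choose k ξ) = ξ
    rw [← h.choose_spec.symm_eq, LinearIsometryEquiv.symm_apply_apply]
  · rw [expI, expI, dif_neg h, dif_neg h]
    rfl

variable [CompleteSpace H]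

theorem adjoint_expI (D : H →ₗ.[ℂ] H) (k : ℝ) :
    ContinuousLinearMap.adjoint (expI D k) = expI D (-k) := by
  by_cases h : ∃ W : ℝ → (H ≃ₗᵢ[ℂ] H), IsUnitaryGroupOf D W
  · rw [expI, expI, dif_pos h, dif_pos h, LinearIsometryEquiv.adjoint_eq_symm,
      h.choose_spec.symm_eq]
  · rw [expI, expI, dif_neg h, dif_neg h]
    exact star_one (H →L[ℂ] H)

/-- A unitary involution that preserves the graph of a self-adjoint operator commutes with the
unitary group that it generates. -/
theorem expI_comm_of_graph {D : H →ₗ.[ℂ] H} (hD : IsSelfAdjoint D) {J : H ≃ₗᵢ[ℂ] H}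
    (hJ : ∀ ξ, J (J ξ) = ξ) (hg : ∀ ξ η, (ξ, η) ∈ D.graph → (J ξ, J η) ∈ D.graph) (k : ℝ)
    (ξ : H) : expI D k (J ξ) = J (expI D k ξ) := by
  by_cases h : ∃ W : ℝ → (H ≃ₗᵢ[ℂ] H), IsUnitaryGroupOf D W
  · obtain ⟨W, hW⟩ := h
    have hg' : ∀ ξ η, (J ξ, J η) ∈ D.graph ↔ (ξ, η) ∈ D.graph := by
      refine fun ξ η => ⟨fun h => ?_, hg ξ η⟩
      have h1 := hg _ _ h
      rwa [hJ, hJ] at h1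
    have hder : ∀ (f : ℝ → H) (η : H), HasDerivAt f η 0 → HasDerivAt (fun k => J (f k)) (J η) 0 :=
      fun f η hf => ((J.toContinuousLinearEquiv : H →L[ℂ] H).restrictScalars ℝ).hasFDerivAt
        |>.comp_hasDerivAt (0 : ℝ) hf
    -- The conjugated group has the same generator, because `J` preserves its graph; uniqueness then
    -- gives `J * W k * J = W k`.
    have hW' : IsUnitaryGroupOf D fun k => J * W k * J := by
      refine ⟨?_, ?_, ?_, ?_⟩
      · rw [hW.zero]
        ext ξ
        exact hJ ξ
      · intro s t
        ext ξ
        change J (W (s + t) (J ξ)) = J (W s (J (J (W t (J ξ)))))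
        rw [hJ, hW.add]
        rfl
      · exact fun ξ => J.continuous.comp (hW.cont (J ξ))
      · intro ξ η
        rw [← hg', hW.gen]
        constructor
        · intro h
          have h1 := hder _ _ h
          rwa [map_smul, hJ] at h1
        · intro h
          have h1 := hder _ _ h
          rw [map_smul] at h1
          have e : (fun k => J ((J * W k * J) ξ)) = fun k => W k (J ξ) :=
            funext fun k => hJ (W k (J ξ))
          rwa [e] at h1
    have heq := congrFun (hW.unique hD hW') k
    rw [expI_eq_of_isUnitaryGroupOf hD hW]
    change W k (J ξ) = J (W k ξ)
    have h1 : W k (J ξ) = (J * W k * J) (J ξ) := congrArg (fun T : H ≃ₗᵢ[ℂ] H => T (J ξ)) heq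
    rw [h1]
    change J (W k (J (J ξ))) = _
    rw [hJ]
  · rw [expI, dif_neg h]
    rfl

end Generators

/-! ### The projection onto a summand, pulled back along a similarity -/

section DirectSums

variable {H₁ : Type*} [NormedAddCommGroup H₁] [InnerProductSpace ℂ H₁]
variable {H₂ : Type*} [NormedAddCommGroup H₂] [InnerProductSpace ℂ H₂]

/-- The reflection `1 ⊕ -1` of a direct sum. -/
def reflection : WithLp 2 (H₁ × H₂) ≃ₗᵢ[ℂ] WithLp 2 (H₁ × H₂) :=
  directSumUnitary 1 (LinearIsometryEquiv.neg ℂ)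

theorem reflection_reflection (p : WithLp 2 (H₁ × H₂)) : reflection (reflection p) = p := by
  have h : reflection (reflection p) = WithLp.toLp 2 (p.fst, - -p.snd) := rfl
  rw [h, neg_neg]
  rfl

/-- The projection of a direct sum onto its first summand. -/
def projFst : WithLp 2 (H₁ × H₂) →L[ℂ] WithLp 2 (H₁ × H₂) :=
  (2 : ℂ)⁻¹ • (1 + ((reflection : WithLp 2 (H₁ × H₂) ≃ₗᵢ[ℂ] _).toContinuousLinearEquiv :
    WithLp 2 (H₁ × H₂) →L[ℂ] WithLp 2 (H₁ × H₂)))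

theorem projFst_eq (p : WithLp 2 (H₁ × H₂)) :
    projFst p = (2 : ℂ)⁻¹ • (p + reflection p) := rfl

theorem projFst_apply (p : WithLp 2 (H₁ × H₂)) : projFst p = WithLp.toLp 2 (p.fst, 0) := by
  have h : projFst p = WithLp.toLp 2 ((2 : ℂ)⁻¹ • (p.fst + p.fst), (2 : ℂ)⁻¹ • (p.snd + -p.snd)) :=
    rfl
  rw [h, add_neg_cancel, smul_zero, ← two_smul ℂ p.fst, smul_smul, inv_mul_cancel₀ two_ne_zero,
    one_smul]

theorem reflection_mem_graph (D₁ : H₁ →ₗ.[ℂ] H₁) (D₂ : H₂ →ₗ.[ℂ] H₂)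
    (ξ η : WithLp 2 (H₁ × H₂)) (h : (ξ, η) ∈ (directSumOp D₁ D₂).graph) :
    (reflection ξ, reflection η) ∈ (directSumOp D₁ D₂).graph := by
  obtain ⟨p, hp1, hp2⟩ := (LinearPMap.mem_graph_iff _).1 h
  have hp1' : (p : WithLp 2 (H₁ × H₂)) = ξ := hp1
  have hp2' : directSumOp D₁ D₂ p = η := hp2
  subst hp1' hp2'
  rw [LinearPMap.mem_graph_iff]
  refine ⟨⟨reflection p.1, p.2.1, D₂.domain.neg_mem p.2.2⟩, rfl, ?_⟩
  exact congrArg (WithLp.toLp 2) (Prod.ext rfl (D₂.map_neg ⟨p.1.snd, p.2.2⟩))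

variable {H : Type*} [NormedAddCommGroup H] [InnerProductSpace ℂ H]

/-- The projection of `H` that corresponds to the first summand under `V`. -/
def pullProj (V : H ≃ₗᵢ[ℂ] WithLp 2 (H₁ × H₂)) : H →L[ℂ] H :=
  (V.symm.toContinuousLinearEquiv : WithLp 2 (H₁ × H₂) →L[ℂ] H) ∘L projFst ∘L
    (V.toContinuousLinearEquiv : H →L[ℂ] WithLp 2 (H₁ × H₂))

theorem pullProj_apply (V : H ≃ₗᵢ[ℂ] WithLp 2 (H₁ × H₂)) (ξ : H) :
    pullProj V ξ = V.symm (projFst (V ξ)) := rfl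

variable [CompleteSpace H] [CompleteSpace H₁] [CompleteSpace H₂]

/-- `expI_comm_of_graph` concerns unitary involutions, so it is applied to the reflection `J`; the
projection is `(1 + J) / 2`. The group of the direct sum need not be computed. -/
theorem expI_directSumOp_projFst {D₁ : H₁ →ₗ.[ℂ] H₁} {D₂ : H₂ →ₗ.[ℂ] H₂}
    (h₁ : IsSelfAdjoint D₁) (h₂ : IsSelfAdjoint D₂) (k : ℝ) (p : WithLp 2 (H₁ × H₂)) :
    expI (directSumOp D₁ D₂) k (projFst p) = projFst (expI (directSumOp D₁ D₂) k p) := by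
  rw [projFst_eq, projFst_eq, map_smul, map_add,
    expI_comm_of_graph (directSumOp_isSelfAdjoint h₁ h₂) reflection_reflection
      (reflection_mem_graph D₁ D₂)]

/-- The projection commutes with the group of `D₁ ⊕ D₂`, which can thus be inserted together with
its inverse. The conjugates of the pulled-back projection take the form `C* P C`, where `C` is the
norm continuous flow of `V`. -/
theorem isUniformOp_pullProj {D : H →ₗ.[ℂ] H} {D₁ : H₁ →ₗ.[ℂ] H₁} {D₂ : H₂ →ₗ.[ℂ] H₂}
    (h₁ : IsSelfAdjoint D₁) (h₂ : IsSelfAdjoint D₂) {V : H ≃ₗᵢ[ℂ] WithLp 2 (H₁ × H₂)}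
    (hV : IsUniformOp D (directSumOp D₁ D₂)
      (V.toContinuousLinearEquiv : H →L[ℂ] WithLp 2 (H₁ × H₂))) :
    IsUniformOp D D (pullProj V) := by
  set C := conjFlow D (directSumOp D₁ D₂)
    (V.toContinuousLinearEquiv : H →L[ℂ] WithLp 2 (H₁ × H₂)) with hC
  have h : conjFlow D D (pullProj V) =
      fun k => ContinuousLinearMap.adjoint (C k) ∘L projFst ∘L C k := by
    funext k
    have hadj : ContinuousLinearMap.adjoint (C k) = expI D k ∘L
        (V.symm.toContinuousLinearEquiv : WithLp 2 (H₁ × H₂) →L[ℂ] H) ∘L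
          expI (directSumOp D₁ D₂) (-k) := by
      rw [hC, conjFlow, ContinuousLinearMap.adjoint_comp, ContinuousLinearMap.adjoint_comp,
        adjoint_expI, adjoint_expI, neg_neg, LinearIsometryEquiv.adjoint_eq_symm]
      rfl
    rw [hadj]
    ext1 ξ
    change expI D k (V.symm (projFst (V (expI D (-k) ξ)))) =
      expI D k (V.symm (expI (directSumOp D₁ D₂) (-k) (projFst
        (expI (directSumOp D₁ D₂) k (V (expI D (-k) ξ))))))
    rw [expI_directSumOp_projFst h₁ h₂, expI_neg_expI]
  rw [IsUniformOp, h]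
  exact (ContinuousLinearMap.adjoint.continuous.comp hV).clm_comp (continuous_const.clm_comp hV)

theorem isIntertwiner_pullProj {W : QuantumWalk H} {W₁ : QuantumWalk H₁} {W₂ : QuantumWalk H₂}
    {V : H ≃ₗᵢ[ℂ] WithLp 2 (H₁ × H₂)} (hV : IsIntertwiner W (W₁.directSum W₂)
      (V.toContinuousLinearEquiv : H →L[ℂ] WithLp 2 (H₁ × H₂))) :
    IsIntertwiner W W (pullProj V) := by
  have hV' : ∀ ξ, V (W.U ξ) = (W₁.directSum W₂).U (V ξ) := hV
  intro ξ
  rw [pullProj_apply, pullProj_apply, LinearIsometryEquiv.symm_apply_eq, hV', hV',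
    LinearIsometryEquiv.apply_symm_apply, projFst_apply, projFst_apply]
  have h : (W₁.directSum W₂).U (WithLp.toLp 2 ((V ξ).fst, 0)) =
      WithLp.toLp 2 (W₁.U (V ξ).fst, W₂.U 0) := rfl
  rw [h, map_zero]
  rfl

end DirectSums

/-! ### Indecomposability from connectedness of the torus -/

section Indecomposable

theorem eq_zero_or_eq_one_of_idempotent {T : Type*} [TopologicalSpace T] [PreconnectedSpace T]
    {ρ : C(T, ℂ)} (h : ρ * ρ = ρ) : ρ = 0 ∨ ρ = 1 := by
  have h01 : ∀ p, ρ p = 0 ∨ ρ p = 1 := by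
    intro p
    have h1 : ρ p * ρ p = ρ p := congrArg (fun f : C(T, ℂ) => f p) h
    by_cases h0 : ρ p = 0
    · exact Or.inl h0
    · exact Or.inr (mul_left_cancel₀ h0 (h1.trans (mul_one _).symm))
  have hclopen : IsClopen {p | ρ p = 0} := by
    refine ⟨isClosed_eq ρ.continuous continuous_const, ?_⟩
    have e : {p | ρ p = 0} = {p | ρ p ≠ 1} := by
      ext p
      refine ⟨fun hp => ?_, fun hp => (h01 p).resolve_right hp⟩
      have hp' : ρ p = 0 := hp
      change ρ p ≠ 1
      rw [hp']
      exact zero_ne_one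
    rw [e]
    exact isOpen_ne_fun ρ.continuous continuous_const
  rcases isClopen_iff.1 hclopen with h0 | h0
  · right
    ext p
    have hp : p ∉ {p | ρ p = 0} := by rw [h0]; exact Set.notMem_empty p
    exact (h01 p).resolve_left hp
  · left
    ext p
    have hp : p ∈ {p | ρ p = 0} := by rw [h0]; exact Set.mem_univ p
    exact hp

variable {r : ℝ} [hr : Fact (0 < r)] {lam : Torus r → Circle}

theorem not_similar_directSum (h : IsAnalyticMap lam) (hp : IsPrimeMap lam)
    {H₁ : Type*} [NormedAddCommGroup H₁] [InnerProductSpace ℂ H₁] [CompleteSpace H₁]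
    [Nontrivial H₁]
    {H₂ : Type*} [NormedAddCommGroup H₂] [InnerProductSpace ℂ H₂] [CompleteSpace H₂]
    [Nontrivial H₂] (W₁ : QuantumWalk H₁) (W₂ : QuantumWalk H₂) :
    ¬ Similar (modelWalk h) (W₁.directSum W₂) := by
  rintro ⟨V, hV, hs⟩
  have hmem : pullProj V ∈ (modelWalk h).uniformCommutant :=
    ⟨isIntertwiner_pullProj hV, isUniformOp_pullProj W₁.selfAdjoint W₂.selfAdjoint hs.continuous⟩
  rw [uniformCommutant_modelWalk h hp] at hmem
  obtain ⟨ρ, hρ⟩ := hmem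
  have hρ' := (fourierPull_eq_mulHom_iff r _ ρ).2 hρ
  have hidem : ρ * ρ = ρ := by
    apply mulHom_injective r
    rw [map_mul, ← hρ']
    ext1 f
    change fourierPull r (pullProj V) (fourierPull r (pullProj V) f) = fourierPull r (pullProj V) f
    rw [fourierPull_apply, fourierPull_apply, LinearIsometryEquiv.apply_symm_apply,
      pullProj_apply, pullProj_apply, LinearIsometryEquiv.apply_symm_apply, projFst_apply,
      projFst_apply]
    rfl
  have hproj : ∀ p : WithLp 2 (H₁ × H₂), projFst p = V (fourierConj ρ (V.symm p)) := by
    intro p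
    rw [← hρ, pullProj_apply, LinearIsometryEquiv.apply_symm_apply,
      LinearIsometryEquiv.apply_symm_apply]
  -- `ρ = 0` makes the projection vanish on the first summand, `ρ = 1` makes it the identity on the
  -- second; both summands are non-zero.
  rcases eq_zero_or_eq_one_of_idempotent hidem with rfl | rfl
  · obtain ⟨x, hx⟩ := exists_ne (0 : H₁)
    have h1 := hproj (WithLp.toLp 2 (x, 0))
    rw [fourierConj_apply, map_zero, zero_apply, map_zero, map_zero, projFst_apply] at h1
    exact hx (congrArg WithLp.fst h1)
  · obtain ⟨x, hx⟩ := exists_ne (0 : H₂)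
    have h1 := hproj (WithLp.toLp 2 (0, x))
    rw [fourierConj_apply, map_one, one_apply_eq_self,
      LinearIsometryEquiv.apply_symm_apply, LinearIsometryEquiv.apply_symm_apply,
      projFst_apply] at h1
    exact hx (congrArg WithLp.snd h1).symm

end Indecomposable

end QW

end

theorem mainTheorem8 (r : ℝ) [Fact (0 < r)] (lam : QW.Torus r → Circle)
    (hlam : QW.IsAnalyticMap lam) (hprime : QW.IsPrimeMap lam) :
    (QW.modelWalk hlam).uniformCommutant =
        {X | ∃ ρ : C(QW.Torus r, ℂ), X = QW.fourierConj ρ} ∧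
      ∀ (H₁ : Type*) [NormedAddCommGroup H₁] [InnerProductSpace ℂ H₁] [CompleteSpace H₁]
        [Nontrivial H₁]
        (H₂ : Type*) [NormedAddCommGroup H₂] [InnerProductSpace ℂ H₂] [CompleteSpace H₂]
        [Nontrivial H₂]
        (W₁ : QW.QuantumWalk H₁) (W₂ : QW.QuantumWalk H₂),
        W₁.IsUniform → W₂.IsUniform →
          ¬ QW.Similar (QW.modelWalk hlam) (W₁.directSum W₂) :=
  ⟨QW.uniformCommutant_modelWalk hlam hprime, fun _ _ _ _ _ _ _ _ _ _ W₁ W₂ _ _ =>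
    QW.not_similar_directSum hlam hprime W₁ W₂⟩
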